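/- Let $d\ge 1$ and let $\mathbb{L}^d=(\mathbb{Z}^d,\mathbb{E}^d)$ be the nearest-neighbour graph on $\mathbb{Z}^d$ ($\{x,y\}\in\mathbb{E}^d$ iff $\sum_i|x_i-y_i|=1$). Identify a subgraph $G=(\mathbb{Z}^d,E)$, $E\subset\mathbb{E}^d$, of $\mathbb{L}^d$ with a point of $\{0,1\}^{\mathbb{E}^d}$, equipped with the product $\sigma$-algebra. Write $C(x)$ for the connected component (cluster) of $x$ in $G$, $I=\{x\in\mathbb{Z}^d: |C(x)|=\infty\}$, and $\Lambda_n=\{x\in\mathbb{Z}^d:\max_i|x_i|\le n\}$. Let $\phi$ be a probability measure on the set of subgraphs of $\mathbb{L}^d$ such that (E) $\phi$ is invariant and ergodic under the action of $\mathbb{Z}^d$ by translations; (M) there is a real $\alpha>d$ with $\sum_{k\ge 1}k^{\alpha}\,\phi(|C(0)|=k)<\infty$. Put $\theta_\phi=\phi(|C(0)|=\infty)$ and $\chi^f(\phi)=\sum_{k\ge1}k\,\phi(|C(0)|=k)$. Let $\nu$ be a probability measure on $\mathbb{R}$ with a finite second moment, $m=\int x\,d\nu(x)$, $\sigma^2=\int(x-m)^2\,d\nu(x)$,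 and let $z\in\mathbb{R}$. For a subgraph $G$ of $\mathbb{L}^d$, let $P^{G,\nu,z}$ be the unique probability measure on $\mathbb{R}^{\mathbb{Z}^d}$ under which the coordinates $(X(x))_{x\in\mathbb{Z}^d}$ satisfy: $X(x)$ has law $\nu$ if $C(x)$ is finite and law $\delta_z$ otherwise; coordinates in the same cluster are almost surely equal; coordinates taken in pairwise different clusters are independent. Let $P^{\phi,\nu,z}=\int P^{G,\nu,z}\,d\phi(G)$, and let $\mathbb{P}$ be the joint law of $(G,X)$, i.e. $\mathbb{P}(A\times B)=\int_A P^{G,\nu,z}(B)\,d\phi(G)$, whose second marginal is $P^{\phi,\nu,z}$. Below, $\Longrightarrow$ denotes convergence in distribution as $n\to\infty$ and $\mathcal{N}(0,0)=\delta_0$. 1. If $\theta_\phi=0$, then $$\frac{1}{|\Lambda_n|^{1/2}}\sum_{x\in\Lambda_n\setminus I}(X(x)-m)\Longrightarrow\mathcal{N}\big(0,\chi^f(\phi)\sigma^2\big)\quad\text{under }\mathbb{P},$$ and, equivalently (as $I=\varnothing$ almost surely), $|\Lambda_n|^{-1/2}\sum_{x\in\Lambda_n}(X(x)-m)\Longrightarrow\mathcal{N}(0,\chi^f(\phi)\sigma^2)$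 under $P^{\phi,\nu,z}$. 2. If $\theta_\phi>0$ and, for some $\sigma_\phi^2>0$, $$\frac{|\Lambda_n\cap I|-\theta_\phi|\Lambda_n|}{|\Lambda_n|^{1/2}}\Longrightarrow\mathcal{N}(0,\sigma_\phi^2)\quad\text{under }\phi,$$ then, under $P^{\phi,\nu,z}$, $$\frac{1}{|\Lambda_n|^{1/2}}\Big(\sum_{x\in\Lambda_n}X(x)-\big((1-\theta_\phi)m+\theta_\phi z\big)|\Lambda_n|\Big)\Longrightarrow\mathcal{N}\big(0,\chi^f(\phi)\sigma^2+(z-m)^2\sigma_\phi^2\big).$$ -/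

import Mathlib

open MeasureTheory ProbabilityTheory Filter Topology

namespace RandomColoring

/-- The vertex set `ℤ^d`. -/
abbrev Vertex (d : ℕ) : Type := Fin d → ℤ

/-- The nearest-neighbour graph `𝕃^d` on `ℤ^d`: `x ∼ y` iff `∑ i, |x i - y i| = 1`. -/
def lattice (d : ℕ) : SimpleGraph (Vertex d) where
  Adj x y := ∑ i, |x i - y i| = 1
  symm := ⟨fun x y h => by simpa only [abs_sub_comm] using h⟩
  loopless := ⟨fun x h => by simp at h⟩

/-- The configuration space `{0,1}^{𝔼^d}` (with its product σ-algebra), identified with the set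
of subgraphs of `𝕃^d` having all of `ℤ^d` as vertex set. -/
abbrev Config (d : ℕ) : Type := (lattice d).edgeSet → Bool

/-- The subgraph of `𝕃^d` formed by the open edges of `ω`. -/
def openGraph {d : ℕ} (ω : Config d) : SimpleGraph (Vertex d) where
  Adj x y := ∃ h : s(x, y) ∈ (lattice d).edgeSet, ω ⟨s(x, y), h⟩ = true
  symm := ⟨fun x y h => by simpa only [Sym2.eq_swap] using h⟩
  loopless := ⟨fun x h => by
    obtain ⟨h, -⟩ := h
    exact (lattice d).loopless.irrefl x h⟩

/-- The cluster `C(x)` of `x`. -/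
def cluster {d : ℕ} (ω : Config d) (x : Vertex d) : Set (Vertex d) :=
  {y | (openGraph ω).Reachable x y}

/-- The set `I` of vertices lying in an infinite cluster. -/
def infiniteVertices {d : ℕ} (ω : Config d) : Set (Vertex d) :=
  {x | (cluster ω x).Infinite}

/-- The box `Λ_n = {x : ‖x‖_∞ ≤ n}`. -/
noncomputable def box (d n : ℕ) : Finset (Vertex d) :=
  Finset.Icc (fun _ => -(n : ℤ)) (fun _ => (n : ℤ))

open Classical in
/-- `Λ_n ∩ I`. -/
noncomputable def boxInfinite {d : ℕ} (n : ℕ) (ω : Config d) : Finset (Vertex d) :=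
  (box d n).filter (· ∈ infiniteVertices ω)

open Classical in
/-- `Λ_n \ I`. -/
noncomputable def boxFinite {d : ℕ} (n : ℕ) (ω : Config d) : Finset (Vertex d) :=
  (box d n).filter (· ∉ infiniteVertices ω)

/-- Translation of an edge by `k`. -/
def shiftEdge {d : ℕ} (k : Vertex d) (e : (lattice d).edgeSet) : (lattice d).edgeSet :=
  ⟨e.1.map (· + k), by
    obtain ⟨e, he⟩ := e
    induction e using Sym2.ind with
    | _ x y => simpa [lattice] using he⟩

/-- The action of `ℤ^d` on configurations by translation. -/
instance instAddActionConfig (d : ℕ) : AddAction (Vertex d) (Config d) where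
  vadd k ω := fun e => ω (shiftEdge k e)
  zero_vadd ω := by
    funext e
    exact congrArg ω (Subtype.ext (by simp [shiftEdge]))
  add_vadd k l ω := by
    funext e
    refine congrArg ω (Subtype.ext ?_)
    simp only [shiftEdge, Sym2.map_map]
    congr 1
    funext x
    simp only [Function.comp]
    abel

/-- Condition (E): `φ` is invariant and ergodic under the translations of `ℤ^d`. -/
abbrev ConditionE {d : ℕ} (φ : Measure (Config d)) : Prop :=
  ErgodicVAdd (Vertex d) (Config d) φ

/-- `φ(|C(0)| = k)`. -/
noncomputable def clusterSizeProb {d : ℕ} (φ : Measure (Config d)) (k : ℕ) : ℝ :=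
  φ.real {ω | (cluster ω 0).encard = (k : ℕ∞)}

/-- Condition (M): `∑_{k ≥ 1} k^α φ(|C(0)| = k) < ∞` for some real `α > d`
(the term `k = 0` vanishes). -/
def ConditionM {d : ℕ} (φ : Measure (Config d)) : Prop :=
  ∃ α : ℝ, (d : ℝ) < α ∧ Summable fun k : ℕ => (k : ℝ) ^ α * clusterSizeProb φ k

/-- `θ_φ = φ(0 ↔ ∞)`. -/
noncomputable def theta {d : ℕ} (φ : Measure (Config d)) : ℝ :=
  φ.real {ω | (0 : Vertex d) ∈ infiniteVertices ω}

/-- `χ^f(φ) = ∑_{k ≥ 1} k φ(|C(0)| = k)`. -/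
noncomputable def chiF {d : ℕ} (φ : Measure (Config d)) : ℝ :=
  ∑' k : ℕ, (k : ℝ) * clusterSizeProb φ k

/-- Under `μ`, the real random variables `Y n` converge in distribution to `𝒩(0, v)`. -/
def TendstoCentredNormal {Ω : Type*} [MeasurableSpace Ω] (μ : Measure Ω) [IsProbabilityMeasure μ]
    (Y : ℕ → Ω → ℝ) (v : ℝ) : Prop :=
  TendstoInDistribution Y atTop (id : ℝ → ℝ) (fun _ => μ) (gaussianReal 0 v.toNNReal)

/-- Condition (CLT) with limiting variance `s`:
`s > 0` and `(|Λ_n ∩ I| - θ_φ |Λ_n|) / |Λ_n|^{1/2} ⟹ 𝒩(0, s)` under `φ`. -/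
def ConditionCLT {d : ℕ} (φ : Measure (Config d)) [IsProbabilityMeasure φ] (s : ℝ) : Prop :=
  0 < s ∧ TendstoCentredNormal φ
    (fun n ω => (((boxInfinite n ω).card : ℝ) - theta φ * ((box d n).card : ℝ)) /
      √((box d n).card : ℝ)) s

/-! ### Colour measures -/

/-- The properties that characterize the colour measure `P^{G,ν,r}` of a graph `G` on `ℤ^d`:
`X_i` has law `ν` if `C(i)` is finite and equals `r` otherwise, variables in pairwise different
clusters are independent, and variables in the same cluster coincide. -/
structure IsColorMeasure {d : ℕ} (ω : Config d) (ν : Measure ℝ) (r : ℝ)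
    (P : Measure (Vertex d → ℝ)) : Prop where
  isProbabilityMeasure : IsProbabilityMeasure P
  law_of_finite : ∀ i, (cluster ω i).Finite → P.map (fun X => X i) = ν
  law_of_infinite : ∀ i, (cluster ω i).Infinite → P.map (fun X => X i) = Measure.dirac r
  indep : ∀ S : Set (Vertex d), (S.Pairwise fun i j => ¬ (openGraph ω).Reachable i j) →
    iIndepFun (fun (i : S) (X : Vertex d → ℝ) => X i) P
  ident : ∀ i j, (openGraph ω).Reachable i j → ∀ᵐ X ∂P, X i = X j

/-- The element of the cluster of `x` that comes first in a fixed enumeration of `ℤ^d`. -/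
noncomputable def root {d : ℕ} (ω : Config d) (x : Vertex d) : Vertex d :=
  Function.argminOn (Encodable.encode : Vertex d → ℕ) (cluster ω x)
    ⟨x, SimpleGraph.Reachable.refl x⟩

open Classical in
/-- The colouring obtained from a field `ξ` of labels: each vertex of a finite cluster takes the
label of the root of that cluster, and each vertex of an infinite cluster takes the value `r`. -/
noncomputable def colorOf {d : ℕ} (r : ℝ) (ω : Config d) (ξ : Vertex d → ℝ) : Vertex d → ℝ :=
  fun x => if (cluster ω x).Finite then ξ (root ω x) else r

/-- The colour measure `P^{ω,ν,r}`: the law of the colouring obtained from independent labels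
of law `ν`. By `isColorMeasure_iff`, it is the only measure with the properties
`IsColorMeasure ω ν r`. -/
noncomputable def colorMeasure {d : ℕ} (ν : Measure ℝ) [IsProbabilityMeasure ν] (r : ℝ)
    (ω : Config d) : Measure (Vertex d → ℝ) :=
  (Measure.infinitePi fun _ : Vertex d => ν).map (colorOf r ω)

theorem measurableSet_adj {d : ℕ} (x y : Vertex d) :
    MeasurableSet {ω : Config d | (openGraph ω).Adj x y} := by
  by_cases h : s(x, y) ∈ (lattice d).edgeSet
  · have : {ω : Config d | (openGraph ω).Adj x y} =
        (fun ω : Config d => ω ⟨s(x, y), h⟩) ⁻¹' {true} := by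
      ext ω
      exact ⟨fun ⟨_, h'⟩ => h', fun h' => ⟨h, h'⟩⟩
    rw [this]
    exact measurable_pi_apply _ (MeasurableSet.singleton _)
  · have : {ω : Config d | (openGraph ω).Adj x y} = ∅ := by
      ext ω
      exact ⟨fun ⟨h', _⟩ => h h', fun h' => h'.elim⟩
    rw [this]
    exact MeasurableSet.empty

theorem measurableSet_reachable {d : ℕ} (x y : Vertex d) :
    MeasurableSet {ω : Config d | (openGraph ω).Reachable x y} := by
  have key : ∀ (n : ℕ) (x : Vertex d),
      MeasurableSet {ω : Config d | ∃ p : (openGraph ω).Walk x y, p.length = n} := by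
    intro n
    induction n with
    | zero =>
      intro x
      by_cases h : x = y
      · subst h
        convert MeasurableSet.univ
        exact Set.eq_univ_of_forall fun ω => ⟨.nil, rfl⟩
      · convert MeasurableSet.empty
        exact Set.eq_empty_of_forall_notMem fun ω ⟨p, hp⟩ =>
          h (SimpleGraph.Walk.eq_of_length_eq_zero hp)
    | succ n ih =>
      intro x
      have : {ω : Config d | ∃ p : (openGraph ω).Walk x y, p.length = n + 1} =
          ⋃ z, {ω : Config d | (openGraph ω).Adj x z} ∩
            {ω : Config d | ∃ p : (openGraph ω).Walk z y, p.length = n} := by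
        ext ω
        simp only [Set.mem_ofPred_eq, Set.mem_iUnion, Set.mem_inter_iff]
        constructor
        · rintro ⟨p, hp⟩
          cases p with
          | nil => simp at hp
          | cons h q => exact ⟨_, h, q, by simpa using hp⟩
        · rintro ⟨z, h, q, hq⟩
          exact ⟨.cons h q, by simpa using hq⟩
      rw [this]
      exact MeasurableSet.iUnion fun z => (measurableSet_adj x z).inter (ih z)
  have : {ω : Config d | (openGraph ω).Reachable x y} =
      ⋃ n, {ω : Config d | ∃ p : (openGraph ω).Walk x y, p.length = n} := by
    ext ω
    simp only [Set.mem_ofPred_eq, Set.mem_iUnion]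
    exact ⟨fun ⟨p⟩ => ⟨_, p, rfl⟩, fun ⟨_, p, _⟩ => ⟨p⟩⟩
  rw [this]
  exact MeasurableSet.iUnion fun n => key n x

theorem measurableSet_cluster_finite {d : ℕ} (x : Vertex d) :
    MeasurableSet {ω : Config d | (cluster ω x).Finite} := by
  have : {ω : Config d | (cluster ω x).Finite} =
      ⋃ S : Finset (Vertex d), ⋂ y, ⋂ _ : y ∉ S,
        {ω : Config d | (openGraph ω).Reachable x y}ᶜ := by
    ext ω
    simp only [Set.mem_ofPred_eq, Set.mem_iUnion, Set.mem_iInter, Set.mem_compl_iff]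
    constructor
    · intro h
      exact ⟨h.toFinset, fun y hy hr => hy (h.mem_toFinset.2 hr)⟩
    · rintro ⟨S, hS⟩
      exact S.finite_toSet.subset fun y hy => by
        by_contra hyS
        exact hS y hyS hy
  rw [this]
  exact MeasurableSet.iUnion fun S => MeasurableSet.iInter fun y => MeasurableSet.iInter fun _ =>
    (measurableSet_reachable x y).compl

theorem root_mem {d : ℕ} (ω : Config d) (x : Vertex d) :
    (openGraph ω).Reachable x (root ω x) :=
  Function.argminOn_mem (Encodable.encode : Vertex d → ℕ) (cluster ω x) _

theorem root_eq_iff {d : ℕ} (ω : Config d) (x y : Vertex d) :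
    root ω x = y ↔ (openGraph ω).Reachable x y ∧ ∀ z, (openGraph ω).Reachable x z →
      Encodable.encode y ≤ Encodable.encode z := by
  have hle : ∀ z, (openGraph ω).Reachable x z →
      Encodable.encode (root ω x) ≤ Encodable.encode z := fun z hz =>
    Function.argminOn_le (Encodable.encode : Vertex d → ℕ) (cluster ω x) hz
  constructor
  · rintro rfl
    exact ⟨root_mem ω x, hle⟩
  · rintro ⟨h1, h2⟩
    exact Encodable.encode_injective (le_antisymm (hle y h1) (h2 _ (root_mem ω x)))

theorem root_congr {d : ℕ} {ω : Config d} {x y : Vertex d} (h : (openGraph ω).Reachable x y) :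
    root ω x = root ω y :=
  (root_eq_iff ω x _).2 ⟨h.trans (root_mem ω y), fun z hz =>
    ((root_eq_iff ω y _).1 rfl).2 z (h.symm.trans hz)⟩

theorem cluster_congr {d : ℕ} {ω : Config d} {x y : Vertex d}
    (h : (openGraph ω).Reachable x y) : cluster ω x = cluster ω y :=
  Set.ext fun _ => ⟨fun hz => h.symm.trans hz, fun hz => h.trans hz⟩

theorem measurable_root {d : ℕ} (x : Vertex d) : Measurable fun ω : Config d => root ω x := by
  refine measurable_to_countable' fun y => ?_
  have : (fun ω : Config d => root ω x) ⁻¹' {y} =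
      {ω : Config d | (openGraph ω).Reachable x y} ∩
        ⋂ z, ⋂ _ : ¬ Encodable.encode y ≤ Encodable.encode z,
          {ω : Config d | (openGraph ω).Reachable x z}ᶜ := by
    ext ω
    simp only [Set.mem_preimage, Set.mem_singleton_iff, root_eq_iff, Set.mem_inter_iff,
      Set.mem_ofPred_eq, Set.mem_iInter, Set.mem_compl_iff]
    exact and_congr_right fun _ => forall_congr' fun z => by tauto
  rw [this]
  exact (measurableSet_reachable x y).inter (MeasurableSet.iInter fun z =>
    MeasurableSet.iInter fun _ => (measurableSet_reachable x z).compl)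

theorem measurable_colorOf {d : ℕ} (r : ℝ) :
    Measurable fun p : Config d × (Vertex d → ℝ) => colorOf r p.1 p.2 := by
  refine measurable_pi_lambda _ fun x => ?_
  refine Measurable.ite (measurable_fst (measurableSet_cluster_finite x)) ?_ measurable_const
  have h : Measurable fun q : (Vertex d → ℝ) × Vertex d => q.1 q.2 :=
    measurable_from_prod_countable_left fun y => measurable_pi_apply y
  exact h.comp (measurable_snd.prodMk ((measurable_root x).comp measurable_fst))

theorem measurable_colorOf_right {d : ℕ} (r : ℝ) (ω : Config d) : Measurable (colorOf r ω) :=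
  (measurable_colorOf r).comp measurable_prodMk_left

theorem measurable_colorMeasure {d : ℕ} (ν : Measure ℝ) [IsProbabilityMeasure ν] (r : ℝ) :
    Measurable (colorMeasure ν r : Config d → Measure (Vertex d → ℝ)) := by
  have h : (colorMeasure ν r : Config d → Measure (Vertex d → ℝ)) = fun ω =>
      ((Measure.infinitePi fun _ : Vertex d => ν).map (Prod.mk ω)).map
        (fun p : Config d × (Vertex d → ℝ) => colorOf r p.1 p.2) := by
    funext ω
    rw [Measure.map_map (measurable_colorOf r) measurable_prodMk_left]
    rfl
  rw [h]
  exact (Measure.measurable_map _ (measurable_colorOf r)).comp Measurable.map_prodMk_left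

theorem isColorMeasure_colorMeasure {d : ℕ} (ν : Measure ℝ) [IsProbabilityMeasure ν] (r : ℝ)
    (ω : Config d) : IsColorMeasure ω ν r (colorMeasure ν r ω) := by
  have hm := measurable_colorOf_right r ω
  have hp : IsProbabilityMeasure (colorMeasure ν r ω) :=
    Measure.isProbabilityMeasure_map hm.aemeasurable
  refine ⟨hp, fun i hi => ?_, fun i hi => ?_, fun S hS => ?_, fun i j hij => ?_⟩
  · rw [colorMeasure, Measure.map_map (measurable_pi_apply i) hm]
    have : ((fun X : Vertex d → ℝ => X i) ∘ colorOf r ω) = fun ξ => ξ (root ω i) := by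
      funext ξ
      simp [colorOf, hi]
    rw [this]
    exact Measure.infinitePi_map_eval (fun _ : Vertex d => ν) _
  · rw [colorMeasure, Measure.map_map (measurable_pi_apply i) hm]
    have : ((fun X : Vertex d → ℝ => X i) ∘ colorOf r ω) = fun _ => r := by
      funext ξ
      simp [colorOf, hi]
    rw [this, Measure.map_const]
    simp
  · classical
    have hinj : Function.Injective fun i : S => root ω i := by
      intro i j hij
      by_contra hne
      refine hS i.2 j.2 (fun h => hne (Subtype.ext h)) ?_
      have h1 := root_mem ω i
      rw [show root ω i = root ω j from hij] at h1
      exact h1.trans (root_mem ω j).symm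
    have h1 : iIndepFun (fun (x : Vertex d) (ξ : Vertex d → ℝ) => ξ x)
        (Measure.infinitePi fun _ : Vertex d => ν) :=
      iIndepFun_infinitePi (X := fun _ t => t) (by fun_prop)
    have h2 := (h1.precomp hinj).comp
      (fun i t => if (cluster ω (i : Vertex d)).Finite then t else r)
      (fun i => by split_ifs <;> fun_prop)
    have h3 : ∀ i : S, Measurable
        ((fun t : ℝ => if (cluster ω (i : Vertex d)).Finite then t else r) ∘
          fun ξ : Vertex d → ℝ => ξ (root ω i)) := fun i =>
      Measurable.comp (by split_ifs <;> fun_prop) (by fun_prop)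
    rw [iIndepFun_iff_map_fun_eq_infinitePi_map (fun i => h3 i)] at h2
    rw [iIndepFun_iff_map_fun_eq_infinitePi_map (fun i => by fun_prop)]
    rw [colorMeasure, Measure.map_map (by fun_prop) hm]
    refine Eq.trans h2 ?_
    congr 1
    funext i
    rw [Measure.map_map (by fun_prop) hm]
    rfl
  · rw [colorMeasure]
    refine (ae_map_iff hm.aemeasurable (measurableSet_eq_fun (by fun_prop) (by fun_prop))).2
      (Eventually.of_forall fun ξ => ?_)
    have h1 := cluster_congr hij
    have h2 := root_congr hij
    unfold colorOf
    rw [h1, h2]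

theorem isColorMeasure_iff {d : ℕ} (ν : Measure ℝ) [IsProbabilityMeasure ν] (r : ℝ)
    (ω : Config d) (P : Measure (Vertex d → ℝ)) :
    IsColorMeasure ω ν r P ↔ P = colorMeasure ν r ω := by
  refine ⟨fun h => ?_, fun h => h ▸ isColorMeasure_colorMeasure ν r ω⟩
  have h' := isColorMeasure_colorMeasure ν r ω
  set Q := colorMeasure ν r ω
  have := h.isProbabilityMeasure
  have := h'.isProbabilityMeasure
  let S : Set (Vertex d) := Set.range (root ω)
  let res : (Vertex d → ℝ) → (S → ℝ) := fun X i => X i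
  let ext : (S → ℝ) → (Vertex d → ℝ) := fun Y x => Y ⟨root ω x, x, rfl⟩
  have hres : Measurable res := by fun_prop
  have hext : Measurable ext := by fun_prop
  have hS : S.Pairwise fun i j => ¬ (openGraph ω).Reachable i j := by
    rintro _ ⟨x, rfl⟩ _ ⟨y, rfl⟩ hne hr
    exact hne (root_congr ((root_mem ω x).trans (hr.trans (root_mem ω y).symm)))
  have hmap : ∀ μ : Measure (Vertex d → ℝ), IsColorMeasure ω ν r μ →
      μ = (μ.map res).map ext := by
    intro μ hR
    rw [Measure.map_map hext hres]
    have : ∀ᵐ X ∂μ, (ext ∘ res) X = X := by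
      have h1 : ∀ᵐ X ∂μ, ∀ x, X (root ω x) = X x :=
        ae_all_iff.2 fun x => hR.ident _ _ (root_mem ω x).symm
      filter_upwards [h1] with X hX
      funext x
      exact hX x
    rw [Measure.map_congr this]
    exact Measure.map_id.symm
  rw [hmap P h, hmap Q h']
  congr 1
  have h1 := (iIndepFun_iff_map_fun_eq_infinitePi_map (fun i => by fun_prop)).1 (h.indep S hS)
  have h2 := (iIndepFun_iff_map_fun_eq_infinitePi_map (fun i => by fun_prop)).1 (h'.indep S hS)
  refine (h1.trans ?_).trans h2.symm
  congr 1
  funext i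
  by_cases hi : (cluster ω (i : Vertex d)).Finite
  · rw [h.law_of_finite _ hi, h'.law_of_finite _ hi]
  · rw [h.law_of_infinite _ hi, h'.law_of_infinite _ hi]

/-- The colour measures `P^{ω,ν,r}` as a Markov kernel in the graph `ω`. -/
noncomputable def colorKernel {d : ℕ} (ν : Measure ℝ) [IsProbabilityMeasure ν] (r : ℝ) :
    Kernel (Config d) (Vertex d → ℝ) where
  toFun := colorMeasure ν r
  measurable' := measurable_colorMeasure ν r

instance instIsMarkovKernelColorKernel {d : ℕ} (ν : Measure ℝ) [IsProbabilityMeasure ν] (r : ℝ) :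
    IsMarkovKernel (colorKernel ν r : Kernel (Config d) (Vertex d → ℝ)) :=
  ⟨fun ω => (isColorMeasure_colorMeasure ν r ω).isProbabilityMeasure⟩

/-- The randomized colour measure `P^{φ,ν,r} = ∫ P^{ω,ν,r} dφ(ω)` on `ℝ^{ℤ^d}`. -/
noncomputable abbrev randomColorMeasure {d : ℕ} (φ : Measure (Config d)) (ν : Measure ℝ)
    [IsProbabilityMeasure ν] (r : ℝ) : Measure (Vertex d → ℝ) :=
  φ.bind (colorKernel ν r)

/-- The joint law of the random graph and its random colouring:
`A × B ↦ ∫_A P^{ω,ν,r}(B) dφ(ω)`. -/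
noncomputable abbrev jointColorMeasure {d : ℕ} (φ : Measure (Config d)) (ν : Measure ℝ)
    [IsProbabilityMeasure ν] (r : ℝ) : Measure (Config d × (Vertex d → ℝ)) :=
  φ ⊗ₘ colorKernel ν r

end RandomColoring

open RandomColoring

namespace RandomColoring

/-! Realise the colouring on a product space: a graph of law `φ` and an independent field of i.i.d.
labels of law `ν`, each finite cluster taking the label of its root (`jointColorMeasure_eq_map`,
`randomColorMeasure_eq_map`). By `sum_box_colorOf`, the sum over the box of `X(x) - m` is then
`labelSum`, carried by the finite clusters, plus `(z - m)|Λ_n ∩ I|`, which depends on the graph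
alone.

Given the graph, `labelSum` is a sum of independent centred variables weighted by the sizes of the
traces of the clusters on the box. Its normalised conditional variance is `σ²` times
`normalizedVariance`, which is also the box average of `|C(x) ∩ Λ_n|` over vertices in finite
clusters. The mean ergodic theorem, with the Følner property to control the boundary, makes it
converge in `L¹` to `χ^f` (`tendsto_integral_abs_normalizedVariance_sub`).

A Lindeberg comparison of characteristic functions (`norm_integral_exp_labelSum_sub_le`) replaces
the conditional law by the Gaussian of the same variance. After averaging over the graph, the error
is a small multiple of `χ^f` plus a tail of the mean finite cluster size, so integrability of that
size, which (M) supplies, suffices. Hence the conditional characteristic functions converge in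
`L¹(φ)` to a constant (`tendsto_integral_norm_integral_exp_labelSum_sub`).

Since that limit does not depend on the graph, it factors out against any graph functional of
modulus at most one. So `labelSum` and the fluctuation of `|Λ_n ∩ I|` are asymptotically independent
and their variances add (`tendsto_integral_exp_labelSum_add`). The three claims are three choices of
the graph term. -/

/-! ### Estimates for characteristic functions -/

/-- Exchange the factors one at a time; the untouched ones have modulus at most one. This is
Lindeberg's replacement of each cluster's contribution by a Gaussian. -/
theorem norm_prod_sub_prod_le {ι : Type*} (s : Finset ι) (a b : ι → ℂ)
    (ha : ∀ i ∈ s, ‖a i‖ ≤ 1) (hb : ∀ i ∈ s, ‖b i‖ ≤ 1) :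
    ‖∏ i ∈ s, a i - ∏ i ∈ s, b i‖ ≤ ∑ i ∈ s, ‖a i - b i‖ := by
  classical
  induction s using Finset.induction_on with
  | empty => simp
  | insert j s hj ih =>
    have ha' : ∀ i ∈ s, ‖a i‖ ≤ 1 := fun i hi => ha i (Finset.mem_insert_of_mem hi)
    have hb' : ∀ i ∈ s, ‖b i‖ ≤ 1 := fun i hi => hb i (Finset.mem_insert_of_mem hi)
    rw [Finset.prod_insert hj, Finset.prod_insert hj, Finset.sum_insert hj]
    have h1 : ‖∏ i ∈ s, a i‖ ≤ 1 := by
      rw [norm_prod]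
      exact Finset.prod_le_one (fun _ _ => norm_nonneg _) ha'
    calc ‖a j * ∏ i ∈ s, a i - b j * ∏ i ∈ s, b i‖
        = ‖(a j - b j) * ∏ i ∈ s, a i + b j * (∏ i ∈ s, a i - ∏ i ∈ s, b i)‖ := by ring_nf
      _ ≤ ‖a j - b j‖ * ‖∏ i ∈ s, a i‖ + ‖b j‖ * ‖∏ i ∈ s, a i - ∏ i ∈ s, b i‖ := by
        simpa only [norm_mul] using norm_add_le ((a j - b j) * ∏ i ∈ s, a i)
          (b j * (∏ i ∈ s, a i - ∏ i ∈ s, b i))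
      _ ≤ ‖a j - b j‖ * 1 + 1 * ∑ i ∈ s, ‖a i - b i‖ := by
        gcongr
        · exact hb j (Finset.mem_insert_self j s)
        · exact ih ha' hb'
      _ = _ := by ring

theorem norm_exp_neg_le_one {x : ℝ} (hx : 0 ≤ x) : ‖Complex.exp (-(x : ℂ))‖ ≤ 1 := by
  rw [Complex.norm_exp]
  simpa using hx

/-- A centred square-integrable law has the characteristic function of the normal law of the same
variance up to `o(t ^ 2)` at the origin. -/
theorem charFun_sub_exp_isLittleO {μ : Measure ℝ} [IsProbabilityMeasure μ] (h2 : MemLp id 2 μ)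
    (h0 : ∫ x, x ∂μ = 0) :
    (fun t : ℝ => charFun μ t - Complex.exp (-(((∫ x, x ^ 2 ∂μ) * t ^ 2 / 2 : ℝ) : ℂ)))
      =o[𝓝 0] fun t : ℝ => t ^ 2 := by
  set s := ∫ x, x ^ 2 ∂μ
  -- Both functions have the same second-order Taylor polynomial at the origin, so each is compared
  -- with it.
  have h1 : (fun t : ℝ => charFun μ t - (1 - ((s * t ^ 2 / 2 : ℝ) : ℂ))) =o[𝓝 0]
      fun t : ℝ => t ^ 2 := by
    have ht : ∀ t : ℝ, taylorWithinEval (charFun μ) 2 Set.univ 0 t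
        = 1 - ((s * t ^ 2 / 2 : ℝ) : ℂ) := by
      intro t
      have := taylorWithinEval_charFun_two_zero (P := μ) (X := id) (by fun_prop)
        (by simpa using h2) t
      rw [Measure.map_id] at this
      rw [this]
      have e1 : ∫ x, id x ∂μ = 0 := h0
      have e2 : ∫ x, (id ^ 2 : ℝ → ℝ) x ∂μ = s := rfl
      rw [e1, e2]
      push_cast
      ring
    simp_rw [← ht]
    have := taylor_isLittleO_univ (x₀ := (0 : ℝ)) (n := 2) (contDiff_charFun (n := 2) h2)
    simpa using this
  have h3 : (fun t : ℝ => Complex.exp (-((s * t ^ 2 / 2 : ℝ) : ℂ)) - (1 - ((s * t ^ 2 / 2 : ℝ) : ℂ)))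
      =o[𝓝 0] fun t : ℝ => t ^ 2 := by
    have hd : HasDerivAt Complex.exp 1 0 := by simpa using Complex.hasDerivAt_exp 0
    have hlo := hd.isLittleO
    have ht : Tendsto (fun t : ℝ => -((s * t ^ 2 / 2 : ℝ) : ℂ)) (𝓝 0) (𝓝 0) := by
      have : Continuous fun t : ℝ => -((s * t ^ 2 / 2 : ℝ) : ℂ) := by fun_prop
      simpa using this.tendsto 0
    have := hlo.comp_tendsto ht
    refine (this.congr_left fun t => ?_).trans_isBigO ?_
    · simp
      ring
    · refine Asymptotics.IsBigO.of_bound |s| (Eventually.of_forall fun t => ?_)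
      simp only [Function.comp, sub_zero, norm_neg, Complex.norm_real, Real.norm_eq_abs, abs_div,
        abs_mul]
      have : 0 ≤ |s| * |t ^ 2| := by positivity
      rw [abs_two]
      linarith
  exact (h1.sub h3).congr_left fun t => by ring

/-- Cluster sizes are unbounded, so the local expansion needs a version valid for all `t`. Away from
the origin the trivial bound `2` is at most `(2 / δ ^ 2) * t ^ 2`. -/
theorem exists_norm_charFun_sub_exp_le {μ : Measure ℝ} [IsProbabilityMeasure μ] (h2 : MemLp id 2 μ)
    (h0 : ∫ x, x ∂μ = 0) {ε : ℝ} (hε : 0 < ε) :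
    ∃ δ > 0, ∃ K ≥ 0, ∀ t : ℝ,
      ‖charFun μ t - Complex.exp (-(((∫ x, x ^ 2 ∂μ) * t ^ 2 / 2 : ℝ) : ℂ))‖
        ≤ t ^ 2 * (ε + if δ ≤ |t| then K else 0) := by
  obtain ⟨δ, hδ, h⟩ := Metric.eventually_nhds_iff.1
    ((charFun_sub_exp_isLittleO h2 h0).def hε)
  refine ⟨δ, hδ, 2 / δ ^ 2, by positivity, fun t => ?_⟩
  split_ifs with ht
  · have hs : 0 ≤ ∫ x, x ^ 2 ∂μ := integral_nonneg fun x => sq_nonneg x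
    have h3 : ‖charFun μ t - Complex.exp (-(((∫ x, x ^ 2 ∂μ) * t ^ 2 / 2 : ℝ) : ℂ))‖ ≤ 2 := by
      refine (norm_sub_le _ _).trans ?_
      have := norm_charFun_le_one (μ := μ) t
      have := norm_exp_neg_le_one (x := (∫ x, x ^ 2 ∂μ) * t ^ 2 / 2) (by positivity)
      linarith
    refine h3.trans ?_
    have h4 : δ ^ 2 ≤ t ^ 2 := by
      rw [← sq_abs t]
      gcongr
    calc (2 : ℝ) = δ ^ 2 * (2 / δ ^ 2) := by field_simp
      _ ≤ t ^ 2 * (2 / δ ^ 2) := by gcongr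
      _ ≤ _ := by
        gcongr
        linarith
  · have := @h t (by simpa using not_le.1 ht)
    rw [add_zero, mul_comm (t ^ 2) ε]
    simpa using this

theorem abs_exp_neg_sub_exp_neg_le {x y : ℝ} (hx : 0 ≤ x) (hy : 0 ≤ y) :
    |Real.exp (-x) - Real.exp (-y)| ≤ |x - y| := by
  have key : ∀ {x y : ℝ}, 0 ≤ x → x ≤ y → Real.exp (-x) - Real.exp (-y) ≤ y - x := by
    intro x y hx hxy
    have h1 : Real.exp (-x) - Real.exp (-y) = Real.exp (-x) * (1 - Real.exp (-(y - x))) := by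
      rw [mul_sub, ← Real.exp_add]
      ring_nf
    have h2 := Real.add_one_le_exp (-(y - x))
    have h3 : Real.exp (-x) ≤ 1 := Real.exp_le_one_iff.2 (by linarith)
    have h4 := Real.exp_pos (-x)
    rw [h1]
    nlinarith
  rcases le_total x y with h | h
  · rw [abs_of_nonneg (sub_nonneg.2 (Real.exp_le_exp.2 (by linarith))), abs_sub_comm,
      abs_of_nonneg (by linarith)]
    exact key hx h
  · rw [abs_sub_comm, abs_of_nonneg (sub_nonneg.2 (Real.exp_le_exp.2 (by linarith))),
      abs_of_nonneg (by linarith)]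
    exact key hy h

theorem charFun_centredNormal {v : ℝ} (hv : 0 ≤ v) (t : ℝ) :
    charFun (gaussianReal 0 v.toNNReal) t = ((Real.exp (-(v * t ^ 2 / 2)) : ℝ) : ℂ) := by
  rw [charFun_gaussianReal]
  push_cast
  congr 1
  rw [Real.coe_toNNReal v hv]
  simp

theorem charFun_map_real {Ω : Type*} [MeasurableSpace Ω] {μ : Measure Ω} {Y : Ω → ℝ}
    (hY : AEMeasurable Y μ) (t : ℝ) :
    charFun (μ.map Y) t = ∫ ω, Complex.exp (((t * Y ω : ℝ) : ℂ) * Complex.I) ∂μ := by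
  rw [charFun_apply_real, integral_map hY (by fun_prop)]
  push_cast
  rfl

/-- **Lévy's theorem** for centred normal limits. -/
theorem tendstoCentredNormal_iff {Ω : Type*} [MeasurableSpace Ω] {μ : Measure Ω}
    [IsProbabilityMeasure μ] {Y : ℕ → Ω → ℝ} {v : ℝ} (hv : 0 ≤ v) (hY : ∀ n, AEMeasurable (Y n) μ) :
    TendstoCentredNormal μ Y v ↔ ∀ t : ℝ, Tendsto
      (fun n => ∫ ω, Complex.exp (((t * Y n ω : ℝ) : ℂ) * Complex.I) ∂μ) atTop
      (𝓝 ((Real.exp (-(v * t ^ 2 / 2)) : ℝ) : ℂ)) := by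
  have hiff : TendstoCentredNormal μ Y v ↔ Tendsto (β := ProbabilityMeasure ℝ)
      (fun n => ⟨μ.map (Y n), Measure.isProbabilityMeasure_map (hY n)⟩) atTop
      (𝓝 ⟨(gaussianReal 0 v.toNNReal).map id,
        Measure.isProbabilityMeasure_map aemeasurable_id⟩) :=
    ⟨fun h => h.tendsto, fun h => ⟨hY, aemeasurable_id, h⟩⟩
  refine hiff.trans (ProbabilityMeasure.tendsto_iff_tendsto_charFun.trans
    (forall_congr' fun t => ?_))
  simp only [ProbabilityMeasure.coe_mk, Measure.map_id, charFun_centredNormal hv,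
    charFun_map_real (hY _)]

/-! ### Følner sequences and the mean ergodic theorem -/

/-- A sequence of finite subsets of a group is Følner if the translates of its terms
asymptotically overlap with them. -/
def IsFolner {G : Type*} [Add G] [DecidableEq G] (F : ℕ → Finset G) : Prop :=
  ∀ v : G, Tendsto (fun n => (((F n).filter fun g => v + g ∈ F n).card : ℝ) / (F n).card)
    atTop (𝓝 1)

section MeanErgodic

variable {G : Type*} [AddCommGroup G]

/-- The two sums cancel on the overlap of `F` with its translate. What remains is one boundary term
from each sum, with equally many indices. -/
theorem norm_sum_sub_sum_add_le [DecidableEq G] {H : Type*} [NormedAddCommGroup H] (F : Finset G) (v : G)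
    (a : G → H) {C : ℝ} (ha : ∀ g, ‖a g‖ ≤ C) :
    ‖∑ g ∈ F, a g - ∑ g ∈ F, a (v + g)‖ ≤
      2 * (F.card - (F.filter fun g => v + g ∈ F).card) * C := by
  have h1 : ∑ g ∈ F, a g = ∑ g ∈ F.filter (fun g => g - v ∈ F), a g +
      ∑ g ∈ F.filter (fun g => ¬ g - v ∈ F), a g := (Finset.sum_filter_add_sum_filter_not _ _ _).symm
  have h2 : ∑ g ∈ F, a (v + g) = ∑ g ∈ F.filter (fun g => v + g ∈ F), a (v + g) +
      ∑ g ∈ F.filter (fun g => ¬ v + g ∈ F), a (v + g) :=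
    (Finset.sum_filter_add_sum_filter_not _ _ _).symm
  have himg : F.filter (fun g => g - v ∈ F) = (F.filter fun g => v + g ∈ F).image (v + ·) := by
    ext g
    simp only [Finset.mem_filter, Finset.mem_image]
    constructor
    · rintro ⟨h, h'⟩
      exact ⟨g - v, ⟨h', by simpa using h⟩, by abel⟩
    · rintro ⟨k, ⟨hk, hk'⟩, rfl⟩
      exact ⟨hk', by simpa using hk⟩
  have h3 : ∑ g ∈ F.filter (fun g => g - v ∈ F), a g =
      ∑ g ∈ F.filter (fun g => v + g ∈ F), a (v + g) := by
    rw [himg, Finset.sum_image fun _ _ _ _ h => add_left_cancel h]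
  have hc : (F.filter fun g => g - v ∈ F).card = (F.filter fun g => v + g ∈ F).card := by
    rw [himg, Finset.card_image_of_injective _ (add_right_injective v)]
  have hc1 := Finset.card_filter_add_card_filter_not (s := F) (fun g => g - v ∈ F)
  have hc2 := Finset.card_filter_add_card_filter_not (s := F) (fun g => v + g ∈ F)
  have hb1 : ‖∑ g ∈ F.filter (fun g => ¬ g - v ∈ F), a g‖ ≤
      (F.filter fun g => ¬ g - v ∈ F).card * C := by
    simpa using norm_sum_le_of_le (F.filter fun g => ¬ g - v ∈ F) fun g _ => ha g
  have hb2 : ‖∑ g ∈ F.filter (fun g => ¬ v + g ∈ F), a (v + g)‖ ≤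
      (F.filter fun g => ¬ v + g ∈ F).card * C := by
    simpa using norm_sum_le_of_le (F.filter fun g => ¬ v + g ∈ F) fun g _ => ha (v + g)
  have e1 : ((F.filter fun g => ¬ g - v ∈ F).card : ℝ) =
      F.card - (F.filter fun g => v + g ∈ F).card := by
    rw [← hc, ← hc1]
    push_cast
    ring
  have e2 : ((F.filter fun g => ¬ v + g ∈ F).card : ℝ) =
      F.card - (F.filter fun g => v + g ∈ F).card := by
    rw [eq_sub_iff_add_eq']
    exact_mod_cast hc2
  rw [e1] at hb1
  rw [e2] at hb2
  rw [h1, h2, h3, add_sub_add_left_eq_sub]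
  refine (norm_sub_le _ _).trans ((add_le_add hb1 hb2).trans (le_of_eq ?_))
  ring

open scoped RealInnerProductSpace in
/-- The **mean ergodic theorem** in a Hilbert space: the averages along a Følner sequence of a
vector that is orthogonal to the invariant vectors tend to zero. -/
theorem tendsto_average_of_orthogonal_invariant [DecidableEq G] {H : Type*} [NormedAddCommGroup H]
    [InnerProductSpace ℝ H] [CompleteSpace H] (U : G → H →ₗᵢ[ℝ] H)
    (hU : ∀ x y h, U x (U y h) = U (y + x) h) {F : ℕ → Finset G} (hF : IsFolner F) {h : H}
    (hh : ∀ f, (∀ x, U x f = f) → ⟪f, h⟫ = 0) :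
    Tendsto (fun n => ((F n).card : ℝ)⁻¹ • ∑ g ∈ F n, U g h) atTop (𝓝 0) := by
  let A : ℕ → H →ₗ[ℝ] H := fun n => ((F n).card : ℝ)⁻¹ • ∑ g ∈ F n, (U g).toLinearMap
  have hA : ∀ n k, A n k = ((F n).card : ℝ)⁻¹ • ∑ g ∈ F n, U g k := fun n k => by
    simp [A]
  have hAle : ∀ n k, ‖A n k‖ ≤ ‖k‖ := by
    intro n k
    rw [hA, norm_smul, norm_inv, RCLike.norm_natCast]
    have h1 : ‖∑ g ∈ F n, U g k‖ ≤ (F n).card * ‖k‖ := by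
      simpa using norm_sum_le_of_le (F n) fun g _ => ((U g).norm_map k).le
    rcases (F n).card.eq_zero_or_pos with h0 | h0
    · simp [h0]
    · rw [inv_mul_le_iff₀ (by exact_mod_cast h0)]
      exact h1
  -- The vectors whose averages vanish form a closed subspace, because the averages are
  -- contractions, and it contains every `k - U x k` by the Følner property.
  let Z : Submodule ℝ H :=
    { carrier := {k | Tendsto (fun n => A n k) atTop (𝓝 0)}
      add_mem' := fun {a b} ha hb => by
        simpa using Tendsto.add (Set.mem_ofPred.1 ha) (Set.mem_ofPred.1 hb)
      zero_mem' := by simp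
      smul_mem' := fun c a ha => by
        simpa using Tendsto.const_smul (Set.mem_ofPred.1 ha) c }
  have hZ : ∀ k, k ∈ Z ↔ Tendsto (fun n => A n k) atTop (𝓝 0) := fun k => Iff.rfl
  have hclosed : ∀ k ∈ Z.topologicalClosure, k ∈ Z := by
    intro k hk
    rw [hZ, Metric.tendsto_atTop]
    intro ε hε
    obtain ⟨l, hl, hkl⟩ := Metric.mem_closure_iff.1 hk (ε / 2) (by positivity)
    obtain ⟨N, hN⟩ := Metric.tendsto_atTop.1 ((hZ l).1 hl) (ε / 2) (by positivity)
    refine ⟨N, fun n hn => ?_⟩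
    have h1 := hN n hn
    rw [dist_zero_right] at h1 ⊢
    have h2 := hAle n (k - l)
    rw [dist_eq_norm] at hkl
    calc ‖A n k‖ = ‖A n l + A n (k - l)‖ := by rw [map_sub]; congr 1; abel
      _ ≤ ‖A n l‖ + ‖A n (k - l)‖ := norm_add_le _ _
      _ < ε := by linarith
  have hcob : ∀ x k, k - U x k ∈ Z := by
    intro x k
    rw [hZ]
    refine squeeze_zero_norm (a := fun n => 2 * ‖k‖ *
      (if (F n).card = 0 then 0 else
        1 - (((F n).filter fun g => x + g ∈ F n).card : ℝ) / (F n).card)) (fun n => ?_) ?_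
    · rw [hA]
      split_ifs with h0
      · simp [h0]
      · have h1 := norm_sum_sub_sum_add_le (F n) x (fun g => U g k) (C := ‖k‖)
          fun g => ((U g).norm_map k).le
        have h0' : (0 : ℝ) < (F n).card := by exact_mod_cast Nat.pos_of_ne_zero h0
        simp only [map_sub, hU, Finset.sum_sub_distrib]
        rw [norm_smul, norm_inv, RCLike.norm_natCast, inv_mul_le_iff₀ h0']
        refine h1.trans (le_of_eq ?_)
        field_simp
    · have h1 := (hF x).const_sub 1
      rw [sub_self] at h1
      have h2 : Tendsto (fun n => if (F n).card = 0 then (0 : ℝ) else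
          1 - (((F n).filter fun g => x + g ∈ F n).card : ℝ) / (F n).card) atTop (𝓝 0) := by
        refine squeeze_zero_norm (fun n => ?_) (by simpa using h1.norm)
        split_ifs
        · simp
        · exact le_rfl
      simpa using h2.const_mul (2 * ‖k‖)
  have hfix : ∀ f ∈ Zᗮ, ∀ x, U x f = f := by
    intro f hf x
    have h1 : ⟪f, f - U x f⟫ = 0 := by
      rw [real_inner_comm]
      exact (Submodule.mem_orthogonal Z f).1 hf _ (hcob x f)
    have h2 := (U x).norm_map f
    rw [inner_sub_right, sub_eq_zero] at h1
    -- Orthogonality to `f - U x f` gives `⟪f, U x f⟫ = ‖f‖ ^ 2`; with `‖U x f‖ = ‖f‖` the square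
    -- expands to zero.
    have h3 : ‖f - U x f‖ ^ 2 = 0 := by
      rw [norm_sub_sq_real, h2, ← h1, real_inner_self_eq_norm_sq]
      ring
    have h4 : f - U x f = 0 := by simpa using h3
    exact (sub_eq_zero.1 h4).symm
  -- The double orthogonal complement is the closure, so orthogonality to the invariant vectors,
  -- hence to `Zᗮ`, is enough.
  have hmem : h ∈ Z := by
    refine hclosed _ ?_
    rw [← Submodule.orthogonal_orthogonal_eq_closure, Submodule.mem_orthogonal]
    exact fun f hf => hh f (hfix f hf)
  simpa only [hA] using (hZ h).1 hmem

variable {α : Type*} [MeasurableSpace α] {μ : Measure α} [AddAction G α]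

/-- Every preimage of a measurable set is invariant up to null sets, hence null or conull; a
countable separating family of sets then pins down the value. -/
theorem ae_eq_const_of_forall_vadd_ae_eq [ErgodicVAdd G α μ] {f : α → ℝ} (hf : AEMeasurable f μ)
    (h : ∀ g : G, (fun a => f (g +ᵥ a)) =ᵐ[μ] f) : ∃ c : ℝ, f =ᵐ[μ] Function.const α c := by
  refine exists_eventuallyEq_const_of_forall_separating MeasurableSet fun s hs => ?_
  have h1 : EventuallyConst (f ⁻¹' s) (ae μ) := by
    refine aeconst_of_forall_preimage_vadd_ae_eq G (hf.nullMeasurable hs) fun g => ?_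
    refine ((h g).mono fun a ha => ?_).set_eq
    exact iff_of_eq (congrArg (· ∈ s) ha)
  exact eventuallyConst_set.1 h1

variable [DecidableEq G] [IsProbabilityMeasure μ] [MeasurableConstVAdd G α] [ErgodicVAdd G α μ]

-- Apply the Hilbert space theorem to the Koopman operators on `L²`. By ergodicity the invariant
-- vectors are the constants, and `f` minus its mean is orthogonal to them; on a probability space
-- the `L¹` norm is at most the `L²` norm.
open scoped RealInnerProductSpace in
theorem tendsto_integral_abs_average_sub_of_memLp {F : ℕ → Finset G} (hF : IsFolner F) {f : α → ℝ}
    (hf : MemLp f 2 μ) :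
    Tendsto (fun n => ∫ a, |((F n).card : ℝ)⁻¹ * ∑ g ∈ F n, (f (g +ᵥ a) - ∫ b, f b ∂μ)| ∂μ) atTop
      (𝓝 0) := by
  set c := ∫ b, f b ∂μ
  let U : G → Lp ℝ 2 μ →ₗᵢ[ℝ] Lp ℝ 2 μ := fun g =>
    Lp.compMeasurePreservingₗᵢ ℝ (g +ᵥ ·) (measurePreserving_vadd g μ)
  have hUae : ∀ g k, U g k =ᵐ[μ] fun a => k (g +ᵥ a) := fun g k =>
    Lp.coeFn_compMeasurePreserving k (measurePreserving_vadd g μ)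
  have hcomp : ∀ (g : G) {k l : α → ℝ}, k =ᵐ[μ] l →
      (fun a => k (g +ᵥ a)) =ᵐ[μ] fun a => l (g +ᵥ a) := fun g k l hkl =>
    (measurePreserving_vadd g μ).quasiMeasurePreserving.ae_eq_comp hkl
  have hU : ∀ x y h, U x (U y h) = U (y + x) h := by
    intro x y h
    refine Lp.ext ?_
    filter_upwards [hUae x (U y h), hUae (y + x) h, hcomp x (hUae y h)] with a h1 h2 h3
    rw [h1, h2, h3, add_vadd]
  have hfc : MemLp (fun a => f a - c) 2 μ := hf.sub (memLp_const c)
  let h : Lp ℝ 2 μ := hfc.toLp _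
  have hh : ∀ k : Lp ℝ 2 μ, (∀ x, U x k = k) → ⟪k, h⟫ = 0 := by
    intro k hk
    obtain ⟨e, he⟩ := ae_eq_const_of_forall_vadd_ae_eq (G := G) (μ := μ)
      (Lp.aestronglyMeasurable k).aemeasurable fun g => by
        have := hUae g k
        rw [hk g] at this
        exact this.symm
    rw [L2.inner_def]
    have : ∫ a, ⟪k a, h a⟫ ∂μ = ∫ a, e * (f a - c) ∂μ := by
      refine integral_congr_ae ?_
      filter_upwards [he, hfc.coeFn_toLp] with a h1 h2
      rw [h1]
      simp only [h, h2, Function.const]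
      simp [mul_comm]
    rw [this, integral_const_mul, integral_sub (hf.integrable one_le_two) (integrable_const c)]
    simp [c]
  have hlim := tendsto_average_of_orthogonal_invariant U hU hF hh
  refine squeeze_zero (fun n => integral_nonneg fun a => abs_nonneg _) (fun n => ?_)
    (tendsto_zero_iff_norm_tendsto_zero.1 hlim)
  set B := ((F n).card : ℝ)⁻¹ • ∑ g ∈ F n, U g h
  have hB : B =ᵐ[μ] fun a => ((F n).card : ℝ)⁻¹ * ∑ g ∈ F n, (f (g +ᵥ a) - c) := by
    have h1 : ∀ᵐ a ∂μ, ∀ g ∈ F n, U g h a = f (g +ᵥ a) - c := by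
      rw [eventually_all_finset]
      intro g _
      filter_upwards [hUae g h, hcomp g hfc.coeFn_toLp] with a h2 h3
      rw [h2, h3]
    filter_upwards [h1, Lp.coeFn_smul ((F n).card : ℝ)⁻¹ (∑ g ∈ F n, U g h),
      Lp.coeFn_fun_finsetSum (F n) fun g => U g h] with a h2 h3 h4
    rw [h3, Pi.smul_apply, h4, smul_eq_mul, Finset.sum_congr rfl h2]
  have h5 : ∫ a, |((F n).card : ℝ)⁻¹ * ∑ g ∈ F n, (f (g +ᵥ a) - c)| ∂μ = ∫ a, ‖B a‖ ∂μ :=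
    integral_congr_ae (hB.mono fun a ha => by simp only [ha, Real.norm_eq_abs])
  rw [h5, Lp.norm_def, integral_norm_eq_lintegral_enorm (Lp.aestronglyMeasurable B),
    ← eLpNorm_one_eq_lintegral_enorm]
  refine ENNReal.toReal_mono (Lp.eLpNorm_ne_top B) ?_
  exact eLpNorm_le_eLpNorm_of_exponent_le one_le_two (Lp.aestronglyMeasurable B)

/-- The **mean ergodic theorem** in `L¹` for averages along a Følner sequence. -/
theorem tendsto_integral_abs_average_sub {F : ℕ → Finset G} (hF : IsFolner F) {f : α → ℝ}
    (hf : Integrable f μ) :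
    Tendsto (fun n => ∫ a, |((F n).card : ℝ)⁻¹ * ∑ g ∈ F n, (f (g +ᵥ a) - ∫ b, f b ∂μ)| ∂μ) atTop
      (𝓝 0) := by
  rw [Metric.tendsto_atTop]
  intro ε hε
  -- Approximate `f` in `L¹` by a simple function `k`. By invariance this changes the averages by at
  -- most `‖f - k‖₁` in `L¹`, and the means differ by no more, whence the three thirds of `ε`.
  obtain ⟨k, hk, hkL⟩ := (memLp_one_iff_integrable.2 hf).exists_simpleFunc_eLpNorm_sub_lt
    ENNReal.one_ne_top (ε := ENNReal.ofReal (ε / 3)) (by simpa using hε)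
  have hk2 : MemLp k 2 μ := k.memLp_of_isFiniteMeasure 2 μ
  have hki : Integrable k μ := hk2.integrable one_le_two
  have hd : ∫ a, |f a - k a| ∂μ < ε / 3 := by
    have h1 := integral_norm_eq_lintegral_enorm (hf.sub hki).aestronglyMeasurable
    rw [← eLpNorm_one_eq_lintegral_enorm] at h1
    have h2 : ∫ a, |f a - k a| ∂μ = (eLpNorm (f - ⇑k) 1 μ).toReal := h1
    rw [h2]
    exact (ENNReal.lt_ofReal_iff_toReal_lt (ne_top_of_lt hk)).1 hk
  obtain ⟨N, hN⟩ := Metric.tendsto_atTop.1 (tendsto_integral_abs_average_sub_of_memLp hF hk2)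
    (ε / 3) (by positivity)
  refine ⟨N, fun n hn => ?_⟩
  have h1 := hN n hn
  rw [Real.dist_eq, sub_zero, abs_of_nonneg (integral_nonneg fun a => abs_nonneg _)] at h1 ⊢
  have hsh : ∀ (g : G) {l : α → ℝ}, Integrable l μ → Integrable (fun a => l (g +ᵥ a)) μ :=
    fun g l hl => (measurePreserving_vadd g μ).integrable_comp_of_integrable hl
  have hfk : Integrable (fun a => f a - k a) μ := hf.sub hki
  have hav : ∀ l : α → ℝ, Integrable l μ → ∀ c : ℝ,
      Integrable (fun a => |((F n).card : ℝ)⁻¹ * ∑ g ∈ F n, (l (g +ᵥ a) - c)|) μ := fun l hl c =>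
    ((integrable_finsetSum _ fun g _ => (hsh g hl).sub (integrable_const c)).const_mul _).abs
  have hcd : |∫ a, f a ∂μ - ∫ a, k a ∂μ| ≤ ∫ a, |f a - k a| ∂μ := by
    rw [← integral_sub hf hki]
    exact abs_integral_le_integral_abs
  rcases (F n).card.eq_zero_or_pos with h0 | h0
  · simpa [h0] using hε
  have h0' : (0 : ℝ) < (F n).card := by exact_mod_cast h0
  have hsum : Integrable (fun a => ((F n).card : ℝ)⁻¹ * ∑ g ∈ F n, |f (g +ᵥ a) - k (g +ᵥ a)|) μ :=
    (integrable_finsetSum _ fun g _ => (hsh g hfk).abs).const_mul _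
  have hsumI : ∫ a, ((F n).card : ℝ)⁻¹ * ∑ g ∈ F n, |f (g +ᵥ a) - k (g +ᵥ a)| ∂μ =
      ∫ a, |f a - k a| ∂μ := by
    rw [integral_const_mul, integral_finsetSum _ fun g _ => (hsh g hfk).abs]
    have : ∀ g ∈ F n, ∫ a, |f (g +ᵥ a) - k (g +ᵥ a)| ∂μ = ∫ a, |f a - k a| ∂μ := fun g _ =>
      (measurePreserving_vadd g μ).integral_comp' (f := MeasurableEquiv.vadd g)
        (fun a => |f a - k a|)
    rw [Finset.sum_congr rfl this, Finset.sum_const, nsmul_eq_mul, inv_mul_cancel_left₀ h0'.ne']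
  have hpt : ∀ a, |((F n).card : ℝ)⁻¹ * ∑ g ∈ F n, (f (g +ᵥ a) - ∫ b, f b ∂μ)| ≤
      ((F n).card : ℝ)⁻¹ * ∑ g ∈ F n, |f (g +ᵥ a) - k (g +ᵥ a)| +
      |((F n).card : ℝ)⁻¹ * ∑ g ∈ F n, (k (g +ᵥ a) - ∫ b, k b ∂μ)| +
      ∫ a, |f a - k a| ∂μ := by
    intro a
    have e : ((F n).card : ℝ)⁻¹ * ∑ g ∈ F n, (f (g +ᵥ a) - ∫ b, f b ∂μ) =
        ((F n).card : ℝ)⁻¹ * ∑ g ∈ F n, (f (g +ᵥ a) - k (g +ᵥ a)) +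
        ((F n).card : ℝ)⁻¹ * ∑ g ∈ F n, (k (g +ᵥ a) - ∫ b, k b ∂μ) -
        (∫ b, f b ∂μ - ∫ b, k b ∂μ) := by
      simp only [Finset.sum_sub_distrib, Finset.sum_const, nsmul_eq_mul]
      field_simp
      ring
    rw [e]
    refine (abs_sub _ _).trans (add_le_add ((abs_add_le _ _).trans (add_le_add ?_ le_rfl)) hcd)
    rw [abs_mul, abs_of_nonneg (inv_nonneg.2 h0'.le)]
    gcongr
    exact Finset.abs_sum_le_sum_abs _ _
  have hadd : Integrable (fun a => ((F n).card : ℝ)⁻¹ * ∑ g ∈ F n, |f (g +ᵥ a) - k (g +ᵥ a)| +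
      |((F n).card : ℝ)⁻¹ * ∑ g ∈ F n, (k (g +ᵥ a) - ∫ b, k b ∂μ)|) μ := hsum.add (hav k hki _)
  calc _ ≤ ∫ a, (((F n).card : ℝ)⁻¹ * ∑ g ∈ F n, |f (g +ᵥ a) - k (g +ᵥ a)| +
      |((F n).card : ℝ)⁻¹ * ∑ g ∈ F n, (k (g +ᵥ a) - ∫ b, k b ∂μ)| +
      ∫ a, |f a - k a| ∂μ) ∂μ :=
        integral_mono (hav f hf _) (hadd.add (integrable_const _)) hpt
    _ = ∫ a, |f a - k a| ∂μ +
        ∫ a, |((F n).card : ℝ)⁻¹ * ∑ g ∈ F n, (k (g +ᵥ a) - ∫ b, k b ∂μ)| ∂μ +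
        ∫ a, |f a - k a| ∂μ := by
      rw [integral_add hadd (integrable_const _),
        integral_add hsum (hav k hki _), hsumI]
      simp
    _ < ε := by linarith

end MeanErgodic

/-! ### Boxes -/

variable {d : ℕ}

theorem card_box (d n : ℕ) : (box d n).card = (2 * n + 1) ^ d := by
  have h : (n : ℤ) + 1 - -n = ((2 * n + 1 : ℕ) : ℤ) := by push_cast; ring
  simp only [box, Pi.card_Icc, Int.card_Icc, h, Int.toNat_natCast, Finset.prod_const,
    Finset.card_univ, Fintype.card_fin]

theorem card_box_pos (d n : ℕ) : (0 : ℝ) < (box d n).card := by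
  rw [card_box]
  positivity

theorem mem_box {n : ℕ} {x : Vertex d} : x ∈ box d n ↔ ∀ i, |x i| ≤ n := by
  simp only [box, Finset.mem_Icc, Pi.le_def, abs_le]
  exact forall_and.symm

/-- If `k` bounds the coordinates of `v`, translation by `v` maps the box of radius `n - k` into
that of radius `n`. The ratio of the two volumes is `(1 - 2k / (2n + 1)) ^ d`. -/
theorem isFolner_box (d : ℕ) : IsFolner (box d) := by
  intro v
  obtain ⟨k, hk⟩ : ∃ k : ℕ, ∀ i, |v i| ≤ k := by
    refine ⟨∑ i, (v i).natAbs, fun i => ?_⟩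
    rw [Int.abs_eq_natAbs]
    exact_mod_cast Finset.single_le_sum (f := fun i => (v i).natAbs) (fun _ _ => Nat.zero_le _)
      (Finset.mem_univ i)
  have hlow : Tendsto (fun n : ℕ => ((1 : ℝ) - 2 * k / (2 * n + 1)) ^ d) atTop (𝓝 1) := by
    have h1 : Tendsto (fun n : ℕ => (2 : ℝ) * n + 1) atTop atTop :=
      tendsto_atTop_add_const_right _ _ (tendsto_natCast_atTop_atTop.const_mul_atTop two_pos)
    have h2 := ((h1.const_div_atTop (2 * (k : ℝ))).const_sub 1).pow d
    simpa using h2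
  refine tendsto_of_tendsto_of_tendsto_of_le_of_le' hlow tendsto_const_nhds ?_ ?_
  · filter_upwards [eventually_ge_atTop k] with n hn
    have hsub : box d (n - k) ⊆ (box d n).filter fun g => v + g ∈ box d n := by
      intro g hg
      rw [mem_box] at hg
      rw [Finset.mem_filter, mem_box, mem_box]
      have hc : ((n - k : ℕ) : ℤ) = n - k := by push_cast [hn]; ring
      refine ⟨fun i => ?_, fun i => ?_⟩
      · have := hg i
        omega
      · have h1 := hg i
        have h2 := hk i
        have h3 := abs_add_le (v i) (g i)
        simp only [Pi.add_apply]
        omega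
    have hle : (((2 * (n - k : ℕ) + 1) ^ d : ℕ) : ℝ) ≤
        ((box d n).filter fun g => v + g ∈ box d n).card := by
      rw [← card_box]
      exact_mod_cast Finset.card_le_card hsub
    rw [le_div_iff₀ (card_box_pos d n), card_box]
    refine le_trans (le_of_eq ?_) hle
    push_cast [hn]
    rw [← mul_pow]
    congr 1
    have : (2 * (n : ℝ) + 1) ≠ 0 := by positivity
    field_simp
    ring
  · refine Eventually.of_forall fun n => ?_
    rw [div_le_one (card_box_pos d n)]
    exact_mod_cast Finset.card_filter_le _ _

/-! ### Translations and finite clusters -/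

instance instMeasurableConstVAddConfig (d : ℕ) : MeasurableConstVAdd (Vertex d) (Config d) :=
  ⟨fun k => measurable_pi_lambda _ fun e => measurable_pi_apply (shiftEdge k e)⟩

/-- Fixes the sign convention: `k +ᵥ ω` is `ω` seen from `k`, so its origin is the vertex `k` of
`ω`. -/
theorem openGraph_vadd_adj (k : Vertex d) (ω : Config d) (x y : Vertex d) :
    (openGraph (k +ᵥ ω)).Adj x y ↔ (openGraph ω).Adj (x + k) (y + k) := by
  constructor
  · rintro ⟨h, hω⟩
    exact ⟨(shiftEdge k ⟨s(x, y), h⟩).2, hω⟩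
  · rintro ⟨h, hω⟩
    have h' : s(x, y) ∈ (lattice d).edgeSet := by
      simpa [lattice] using h
    exact ⟨h', hω⟩

theorem openGraph_vadd_reachable (k : Vertex d) (ω : Config d) (x y : Vertex d) :
    (openGraph (k +ᵥ ω)).Reachable x y ↔ (openGraph ω).Reachable (x + k) (y + k) := by
  let e : openGraph (k +ᵥ ω) ≃g openGraph ω :=
    { toEquiv := Equiv.addRight k
      map_rel_iff' := fun {a b} => (openGraph_vadd_adj k ω a b).symm }
  exact (SimpleGraph.Iso.reachable_iff (φ := e)).symm

theorem cluster_vadd (k : Vertex d) (ω : Config d) (x : Vertex d) :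
    cluster (k +ᵥ ω) x = (· - k) '' cluster ω (x + k) := by
  ext y
  simp only [cluster, Set.mem_ofPred_eq, openGraph_vadd_reachable, Set.mem_image]
  exact ⟨fun h => ⟨y + k, h, by simp⟩, by rintro ⟨z, hz, rfl⟩; simpa using hz⟩

open Classical in
/-- The cluster of `x` as a finite set, or `∅` if the cluster is infinite. -/
noncomputable def finCluster (ω : Config d) (x : Vertex d) : Finset (Vertex d) :=
  if h : (cluster ω x).Finite then h.toFinset else ∅

theorem mem_finCluster {ω : Config d} {x y : Vertex d} :
    y ∈ finCluster ω x ↔ (cluster ω x).Finite ∧ (openGraph ω).Reachable x y := by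
  unfold finCluster
  split_ifs with h
  · rw [h.mem_toFinset]
    exact (and_iff_right h).symm
  · simp [h]

theorem finCluster_vadd (k : Vertex d) (ω : Config d) (x : Vertex d) :
    finCluster (k +ᵥ ω) x = (finCluster ω (x + k)).image (· - k) := by
  have hfin : (cluster (k +ᵥ ω) x).Finite ↔ (cluster ω (x + k)).Finite := by
    rw [cluster_vadd, Set.finite_image_iff (sub_left_injective.injOn)]
  ext y
  simp only [mem_finCluster, hfin, openGraph_vadd_reachable, Finset.mem_image]
  exact ⟨fun h => ⟨y + k, h, by simp⟩, by rintro ⟨z, hz, rfl⟩; simpa using hz⟩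

theorem card_finCluster_vadd (k : Vertex d) (ω : Config d) :
    (finCluster (k +ᵥ ω) 0).card = (finCluster ω k).card := by
  rw [finCluster_vadd, zero_add, Finset.card_image_of_injective _ sub_left_injective]

theorem measurableSet_mem_finCluster (x y : Vertex d) :
    MeasurableSet {ω : Config d | y ∈ finCluster ω x} := by
  simp only [mem_finCluster]
  exact (measurableSet_cluster_finite x).inter (measurableSet_reachable x y)

/-- There are only countably many finite vertex sets, and each value of `finCluster` is a measurable
event; hence `g` is arbitrary. -/
theorem measurable_comp_finCluster {E : Type*} [MeasurableSpace E] (x : Vertex d)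
    (g : Finset (Vertex d) → E) : Measurable fun ω : Config d => g (finCluster ω x) := by
  intro B _
  have : (fun ω : Config d => g (finCluster ω x)) ⁻¹' B =
      ⋃ S ∈ {S | g S ∈ B}, ⋂ y, {ω | y ∈ finCluster ω x ↔ y ∈ S} := by
    ext ω
    simp only [Set.mem_preimage, Set.mem_iUnion, Set.mem_iInter, Set.mem_ofPred_eq, exists_prop]
    exact ⟨fun h => ⟨_, h, fun y => Iff.rfl⟩, fun ⟨S, hS, h⟩ => (Finset.ext h) ▸ hS⟩
  rw [this]
  refine MeasurableSet.biUnion (Set.to_countable _) fun S _ => MeasurableSet.iInter fun y => ?_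
  exact (measurableSet_mem_finCluster x y).iff (MeasurableSet.const _)

/-- The value `0` is excluded because it is the size of the placeholder `∅` standing for an infinite
cluster. -/
theorem encard_cluster_eq_iff (ω : Config d) {k : ℕ} (hk : k ≠ 0) :
    (cluster ω 0).encard = k ↔ (finCluster ω 0).card = k := by
  unfold finCluster
  split_ifs with h
  · rw [h.encard_eq_coe_toFinset_card]
    exact Nat.cast_inj
  · rw [Set.Infinite.encard_eq h]
    simp [hk.symm]

theorem map_card_finCluster_real (φ : Measure (Config d)) {k : ℕ} (hk : k ≠ 0) :
    (φ.map fun ω => (finCluster ω 0).card).real {k} = clusterSizeProb φ k := by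
  rw [map_measureReal_apply (measurable_comp_finCluster 0 _) (MeasurableSet.singleton _),
    clusterSizeProb]
  congr 1
  ext ω
  exact (encard_cluster_eq_iff ω hk).symm

/-- Condition (M) makes the size of the finite cluster of the origin integrable. -/
theorem integrable_card_finCluster (hd : 1 ≤ d) {φ : Measure (Config d)} [IsProbabilityMeasure φ]
    (hM : ConditionM φ) : Integrable (fun ω => ((finCluster ω 0).card : ℝ)) φ := by
  obtain ⟨α, hα, hsum⟩ := hM
  have hm : Measurable fun ω : Config d => (finCluster ω 0).card := measurable_comp_finCluster 0 _
  have h1 : Integrable (fun k : ℕ => (k : ℝ)) (φ.map fun ω => (finCluster ω 0).card) := by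
    rw [← Measure.sum_smul_dirac (φ.map fun ω => (finCluster ω 0).card),
      integrable_sum_dirac_iff fun k => measure_ne_top _ _]
    refine hsum.of_nonneg_of_le (fun k => by positivity) fun k => ?_
    have hp : 0 ≤ clusterSizeProb φ k := measureReal_nonneg
    rcases eq_or_ne k 0 with rfl | hk
    · rw [Nat.cast_zero, norm_zero, mul_zero]
      positivity
    · rw [← measureReal_def, map_card_finCluster_real φ hk, mul_comm, Real.norm_natCast]
      gcongr
      have hk1 : (1 : ℝ) ≤ k := by exact_mod_cast Nat.one_le_iff_ne_zero.2 hk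
      have hd1 : (1 : ℝ) ≤ d := by exact_mod_cast hd
      -- `k ≤ k ^ α` since `k ≥ 1` and `α > d ≥ 1`.
      simpa using Real.rpow_le_rpow_of_exponent_le hk1 (hd1.trans hα.le)
  exact h1.comp_measurable hm

theorem integral_card_finCluster (φ : Measure (Config d)) [IsProbabilityMeasure φ]
    (hint : Integrable (fun ω => ((finCluster ω 0).card : ℝ)) φ) :
    ∫ ω, ((finCluster ω 0).card : ℝ) ∂φ = chiF φ := by
  have hm : Measurable fun ω : Config d => (finCluster ω 0).card := measurable_comp_finCluster 0 _
  have h1 : Integrable (fun k : ℕ => (k : ℝ)) (φ.map fun ω => (finCluster ω 0).card) :=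
    (integrable_map_measure (by fun_prop) hm.aemeasurable).2 hint
  have h2 := integral_map (μ := φ) hm.aemeasurable (f := fun k : ℕ => (k : ℝ)) (by fun_prop)
  rw [← h2, integral_countable h1, chiF]
  refine tsum_congr fun k => ?_
  rcases eq_or_ne k 0 with rfl | hk
  · simp
  · rw [map_card_finCluster_real φ hk, smul_eq_mul, mul_comm]

/-! ### Traces of clusters on the box and the conditional variance -/

/-- The number of vertices of the box in the cluster of `x`, or `0` if that cluster is infinite. -/
noncomputable def clusterCount (n : ℕ) (ω : Config d) (x : Vertex d) : ℕ :=
  ((finCluster ω x).filter (· ∈ box d n)).card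

theorem clusterCount_le (n : ℕ) (ω : Config d) (x : Vertex d) :
    clusterCount n ω x ≤ (finCluster ω x).card :=
  Finset.card_filter_le _ _

/-- Recentring at `x` lets invariance of `φ` replace the cluster of `x` by the cluster of the
origin. -/
theorem clusterCount_eq (n : ℕ) (ω : Config d) (x : Vertex d) :
    clusterCount n ω x = ((finCluster (x +ᵥ ω) 0).filter fun v => v + x ∈ box d n).card := by
  rw [finCluster_vadd, zero_add, Finset.filter_image,
    Finset.card_image_of_injective _ sub_left_injective]
  simp [clusterCount]

theorem measurable_clusterCount (n : ℕ) (x : Vertex d) :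
    Measurable fun ω : Config d => (clusterCount n ω x : ℝ) :=
  measurable_comp_finCluster x fun S => ((S.filter (· ∈ box d n)).card : ℝ)

/-- The sum over the finite clusters of the squares of the sizes of their traces on the box,
divided by the volume of the box. -/
noncomputable def normalizedVariance (n : ℕ) (ω : Config d) : ℝ :=
  ((box d n).card : ℝ)⁻¹ * ∑ x ∈ box d n, (clusterCount n ω x : ℝ)

theorem normalizedVariance_nonneg (n : ℕ) (ω : Config d) : 0 ≤ normalizedVariance n ω := by
  unfold normalizedVariance
  positivity

/-- After exchanging the sums, each `v ∈ S` contributes the proportion of the box that `v`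
translates into the box, which tends to `1`. -/
theorem tendsto_average_translated_count (S : Finset (Vertex d)) :
    Tendsto (fun n => ((box d n).card : ℝ)⁻¹ *
      ∑ x ∈ box d n, ((S.filter fun v => v + x ∈ box d n).card : ℝ)) atTop (𝓝 S.card) := by
  have h : ∀ n, ((box d n).card : ℝ)⁻¹ *
      ∑ x ∈ box d n, ((S.filter fun v => v + x ∈ box d n).card : ℝ) =
      ∑ v ∈ S, (((box d n).filter fun x => v + x ∈ box d n).card : ℝ) / (box d n).card := by
    intro n
    simp only [Finset.card_filter, Nat.cast_sum, ← Finset.sum_div]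
    rw [Finset.sum_comm, div_eq_inv_mul]
  simp only [h]
  simpa using tendsto_finsetSum S fun v _ => isFolner_box d v

section ConditionalVariance

variable {φ : Measure (Config d)}

theorem integral_vadd [VAddInvariantMeasure (Vertex d) (Config d) φ] (x : Vertex d)
    (f : Config d → ℝ) : ∫ ω, f (x +ᵥ ω) ∂φ = ∫ ω, f ω ∂φ :=
  (measurePreserving_vadd x φ).integral_comp' (f := MeasurableEquiv.vadd x) f

theorem integrable_card_finCluster_apply [VAddInvariantMeasure (Vertex d) (Config d) φ]
    (hint : Integrable (fun ω => ((finCluster ω 0).card : ℝ)) φ) (x : Vertex d) :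
    Integrable (fun ω => ((finCluster ω x).card : ℝ)) φ := by
  have := (measurePreserving_vadd x φ).integrable_comp_of_integrable hint
  simpa only [Function.comp_def, card_finCluster_vadd] using this

theorem integrable_clusterCount [VAddInvariantMeasure (Vertex d) (Config d) φ]
    (hint : Integrable (fun ω => ((finCluster ω 0).card : ℝ)) φ) (n : ℕ) (x : Vertex d) :
    Integrable (fun ω => (clusterCount n ω x : ℝ)) φ :=
  (integrable_card_finCluster_apply hint x).mono' (measurable_clusterCount n x).aestronglyMeasurable
    (Eventually.of_forall fun ω => by
      rw [Real.norm_natCast]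
      exact_mod_cast clusterCount_le n ω x)

theorem integrable_normalizedVariance [VAddInvariantMeasure (Vertex d) (Config d) φ]
    (hint : Integrable (fun ω => ((finCluster ω 0).card : ℝ)) φ) (n : ℕ) :
    Integrable (normalizedVariance n) φ :=
  (integrable_finsetSum _ fun x _ => integrable_clusterCount hint n x).const_mul _

theorem tendsto_integral_normalizedVariance [VAddInvariantMeasure (Vertex d) (Config d) φ]
    (hint : Integrable (fun ω => ((finCluster ω 0).card : ℝ)) φ) :
    Tendsto (fun n => ∫ ω, normalizedVariance n ω ∂φ) atTop
      (𝓝 (∫ ω, ((finCluster ω 0).card : ℝ) ∂φ)) := by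
  let g : ℕ → Vertex d → Config d → ℝ := fun n x ω =>
    ((finCluster ω 0).filter fun v => v + x ∈ box d n).card
  have hgm : ∀ n x, Measurable (g n x) := fun n x =>
    measurable_comp_finCluster 0 fun S => ((S.filter fun v => v + x ∈ box d n).card : ℝ)
  have hgle : ∀ n x ω, g n x ω ≤ (finCluster ω 0).card := fun n x ω => by
    exact Nat.cast_le.2 (Finset.card_filter_le _ _)
  have hg0 : ∀ n x ω, 0 ≤ g n x ω := fun n x ω => Nat.cast_nonneg _
  have hgi : ∀ n x, Integrable (g n x) φ := fun n x =>
    hint.mono' (hgm n x).aestronglyMeasurable (Eventually.of_forall fun ω => by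
      rw [Real.norm_of_nonneg (hg0 n x ω)]
      exact hgle n x ω)
  -- Only the integrals agree, not the integrands. On the right a single cluster is averaged over
  -- its translates, dominated by its full size.
  have hV : ∀ n, ∫ ω, normalizedVariance n ω ∂φ =
      ∫ ω, ((box d n).card : ℝ)⁻¹ * ∑ x ∈ box d n, g n x ω ∂φ := by
    intro n
    unfold normalizedVariance
    rw [integral_const_mul, integral_const_mul,
      integral_finsetSum _ fun x _ => integrable_clusterCount hint n x,
      integral_finsetSum _ fun x _ => hgi n x]
    congr 1
    refine Finset.sum_congr rfl fun x _ => ?_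
    rw [← integral_vadd x (g n x)]
    simp only [clusterCount_eq, g]
  simp only [hV]
  refine tendsto_integral_of_dominated_convergence (fun ω => ((finCluster ω 0).card : ℝ))
    (fun n => ((Finset.measurable_fun_sum _ fun x _ => hgm n x).const_mul _).aestronglyMeasurable)
    hint (fun n => Eventually.of_forall fun ω => ?_)
    (Eventually.of_forall fun ω => tendsto_average_translated_count (finCluster ω 0))
  have h0 : 0 ≤ ∑ x ∈ box d n, g n x ω := Finset.sum_nonneg fun x _ => hg0 n x ω
  rw [Real.norm_of_nonneg (mul_nonneg (inv_nonneg.2 (Nat.cast_nonneg _)) h0),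
    inv_mul_le_iff₀ (card_box_pos d n), ← nsmul_eq_mul]
  exact Finset.sum_le_card_nsmul _ _ _ fun x _ => hgle n x ω

/-- The conditional variance converges in `L¹` to the mean size of the finite cluster. -/
theorem tendsto_integral_abs_normalizedVariance_sub [IsProbabilityMeasure φ] (hE : ConditionE φ)
    (hint : Integrable (fun ω => ((finCluster ω 0).card : ℝ)) φ) :
    Tendsto (fun n => ∫ ω, |normalizedVariance n ω - ∫ ω', ((finCluster ω' 0).card : ℝ) ∂φ| ∂φ)
      atTop (𝓝 0) := by
  have hlim := tendsto_integral_normalizedVariance hint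
  have herg := tendsto_integral_abs_average_sub (μ := φ) (isFolner_box d) hint
  obtain ⟨χ, hχ⟩ : ∃ χ, χ = ∫ ω, ((finCluster ω 0).card : ℝ) ∂φ := ⟨_, rfl⟩
  rw [← hχ] at hlim
  simp only [← hχ] at herg ⊢
  -- `A` counts whole finite clusters, so it is an ergodic average with mean `χ` and dominates the
  -- truncated average. A nonnegative difference has `L¹` norm equal to its integral, so convergence
  -- of the means suffices.
  let A : ℕ → Config d → ℝ := fun n ω =>
    ((box d n).card : ℝ)⁻¹ * ∑ x ∈ box d n, ((finCluster ω x).card : ℝ)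
  have hAi : ∀ n, Integrable (A n) φ := fun n =>
    (integrable_finsetSum _ fun x _ => integrable_card_finCluster_apply hint x).const_mul _
  have hA : Tendsto (fun n => ∫ ω, |A n ω - χ| ∂φ) atTop (𝓝 0) := by
    refine herg.congr fun n => integral_congr_ae (Eventually.of_forall fun ω => ?_)
    have := (card_box_pos d n).ne'
    simp only [card_finCluster_vadd, Finset.sum_sub_distrib, Finset.sum_const, nsmul_eq_mul, A,
      mul_sub]
    rw [inv_mul_cancel_left₀ this]
  have hAint : ∀ n, ∫ ω, A n ω ∂φ = χ := by
    intro n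
    simp only [A]
    rw [integral_const_mul, integral_finsetSum _ fun x _ => integrable_card_finCluster_apply hint x]
    have : ∀ x ∈ box d n, ∫ ω, ((finCluster ω x).card : ℝ) ∂φ = χ := fun x _ => by
      rw [hχ, ← integral_vadd x fun ω => ((finCluster ω 0).card : ℝ)]
      simp only [card_finCluster_vadd]
    rw [Finset.sum_congr rfl this, Finset.sum_const, nsmul_eq_mul,
      inv_mul_cancel_left₀ (card_box_pos d n).ne']
  have hVA : ∀ n ω, normalizedVariance n ω ≤ A n ω := fun n ω => by
    unfold normalizedVariance
    simp only [A]
    gcongr with x hx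
    exact_mod_cast clusterCount_le n ω x
  have hVi := integrable_normalizedVariance (φ := φ) hint
  have hsum : Tendsto (fun n => (χ - ∫ ω, normalizedVariance n ω ∂φ) + ∫ ω, |A n ω - χ| ∂φ) atTop
      (𝓝 0) := by
    simpa using (hlim.const_sub χ).add hA
  refine squeeze_zero (fun n => integral_nonneg fun ω => abs_nonneg _) (fun n => ?_) hsum
  have hAVi : Integrable (fun ω => A n ω - normalizedVariance n ω) φ := (hAi n).sub (hVi n)
  have hAχ : Integrable (fun ω => |A n ω - χ|) φ := ((hAi n).sub (integrable_const χ)).abs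
  rw [← hAint n, ← integral_sub (hAi n) (hVi n), hAint n, ← integral_add hAVi hAχ]
  refine integral_mono ((hVi n).sub (integrable_const χ)).abs (hAVi.add hAχ) fun ω => ?_
  have h1 := hVA n ω
  have h2 : |normalizedVariance n ω - χ| ≤ |normalizedVariance n ω - A n ω| + |A n ω - χ| :=
    abs_sub_le _ _ _
  rw [abs_sub_comm (normalizedVariance n ω) (A n ω),
    abs_of_nonneg (sub_nonneg.2 h1)] at h2
  exact h2

end ConditionalVariance

/-! ### Sums of labels grouped by cluster -/

theorem root_eq_root_iff {ω : Config d} {x y : Vertex d} :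
    root ω x = root ω y ↔ (openGraph ω).Reachable x y :=
  ⟨fun h => (root_mem ω x).trans (h ▸ (root_mem ω y).symm), root_congr⟩

theorem mem_boxFinite {n : ℕ} {ω : Config d} {x : Vertex d} :
    x ∈ boxFinite n ω ↔ x ∈ box d n ∧ (cluster ω x).Finite := by
  classical
  unfold boxFinite
  rw [Finset.mem_filter]
  exact and_congr_right fun _ => not_not

/-- The number of vertices of `Λ_n \ I` whose cluster has root `r`. -/
noncomputable def rootCount (n : ℕ) (ω : Config d) (r : Vertex d) : ℕ :=
  ((boxFinite n ω).filter fun x => root ω x = r).card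

theorem rootCount_root {n : ℕ} {ω : Config d} {x : Vertex d} (hx : x ∈ boxFinite n ω) :
    rootCount n ω (root ω x) = clusterCount n ω x := by
  unfold rootCount clusterCount
  congr 1
  ext y
  rw [mem_boxFinite] at hx
  simp only [Finset.mem_filter, mem_boxFinite, mem_finCluster, root_eq_root_iff]
  constructor
  · rintro ⟨⟨h1, -⟩, h3⟩
    exact ⟨⟨hx.2, h3.symm⟩, h1⟩
  · rintro ⟨⟨h1, h2⟩, h3⟩
    exact ⟨⟨h3, cluster_congr h2 ▸ h1⟩, h2.symm⟩

theorem clusterCount_eq_zero {n : ℕ} {ω : Config d} {x : Vertex d} (hx : ¬ (cluster ω x).Finite) :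
    clusterCount n ω x = 0 := by
  simp [clusterCount, finCluster, hx]

/-- A cluster with `k` vertices in the box is met `k` times in a sum over vertices, which absorbs
one factor `k`. With `h = 1` this is the conditional variance; a truncation as `h` gives the
Lindeberg error. -/
theorem sum_rootCount_mul (n : ℕ) (ω : Config d) (h : ℕ → ℝ) :
    ∑ r ∈ (boxFinite n ω).image (root ω), (rootCount n ω r : ℝ) ^ 2 * h (rootCount n ω r) =
      ∑ x ∈ box d n, (clusterCount n ω x : ℝ) * h (clusterCount n ω x) := by
  have h1 := Finset.sum_comp (s := boxFinite n ω)
    (fun r => (rootCount n ω r : ℝ) * h (rootCount n ω r)) (root ω)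
  have h2 : ∑ x ∈ boxFinite n ω, (clusterCount n ω x : ℝ) * h (clusterCount n ω x) =
      ∑ x ∈ box d n, (clusterCount n ω x : ℝ) * h (clusterCount n ω x) := by
    refine Finset.sum_subset (fun x hx => (mem_boxFinite.1 hx).1) fun x hx hx' => ?_
    rw [clusterCount_eq_zero fun hf => hx' (mem_boxFinite.2 ⟨hx, hf⟩)]
    simp
  have h3 : ∑ x ∈ boxFinite n ω, (clusterCount n ω x : ℝ) * h (clusterCount n ω x) =
      ∑ x ∈ boxFinite n ω, (rootCount n ω (root ω x) : ℝ) * h (rootCount n ω (root ω x)) :=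
    Finset.sum_congr rfl fun x hx => by rw [rootCount_root hx]
  rw [← h2, h3, h1]
  refine Finset.sum_congr rfl fun r _ => ?_
  rw [nsmul_eq_mul, sq, mul_assoc]
  rfl

/-- The centred sum of the labels of the vertices of `Λ_n \ I`. -/
noncomputable def labelSum (m : ℝ) (n : ℕ) (ω : Config d) (ξ : Vertex d → ℝ) : ℝ :=
  ∑ x ∈ boxFinite n ω, (ξ (root ω x) - m)

theorem sum_boxFinite_eq_sum_ite (n : ℕ) (ω : Config d) (f : Vertex d → ℝ) :
    ∑ x ∈ boxFinite n ω, f x = ∑ x ∈ box d n, (infiniteVertices ω)ᶜ.indicator f x := by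
  classical
  simp only [Set.indicator_apply, Set.mem_compl_iff, ← Finset.sum_filter]
  unfold boxFinite
  congr!

/-- Grouping by root exhibits a weighted sum of independent variables for a fixed graph. -/
theorem labelSum_eq_rootSum (m : ℝ) (n : ℕ) (ω : Config d) (ξ : Vertex d → ℝ) :
    labelSum m n ω ξ =
      ∑ r ∈ (boxFinite n ω).image (root ω), (rootCount n ω r : ℝ) * (ξ r - m) := by
  rw [labelSum, Finset.sum_comp (fun r => ξ r - m) (root ω)]
  simp only [nsmul_eq_mul]
  rfl

theorem labelSum_eq_colorOf (m z : ℝ) (n : ℕ) (ω : Config d) (ξ : Vertex d → ℝ) :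
    labelSum m n ω ξ = ∑ x ∈ boxFinite n ω, (colorOf z ω ξ x - m) :=
  Finset.sum_congr rfl fun x hx => by simp [colorOf, (mem_boxFinite.1 hx).2]

theorem sum_box_colorOf (m z : ℝ) (n : ℕ) (ω : Config d) (ξ : Vertex d → ℝ) :
    ∑ x ∈ box d n, (colorOf z ω ξ x - m) =
      labelSum m n ω ξ + (z - m) * (boxInfinite n ω).card := by
  classical
  rw [labelSum_eq_colorOf m z,
    ← Finset.sum_filter_add_sum_filter_not (box d n) (· ∉ infiniteVertices ω)]
  have h1 : boxFinite n ω = (box d n).filter (· ∉ infiniteVertices ω) := by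
    unfold boxFinite; congr!
  have h2 : boxInfinite n ω = (box d n).filter (fun x => ¬ x ∉ infiniteVertices ω) := by
    unfold boxInfinite
    simp only [not_not]
  rw [h1, h2]
  congr 1
  have : ∀ x ∈ (box d n).filter (fun x => ¬ x ∉ infiniteVertices ω),
      colorOf z ω ξ x - m = z - m := by
    intro x hx
    have hx' : ¬ (cluster ω x).Finite := not_not.1 (Finset.mem_filter.1 hx).2
    simp [colorOf, hx']
  rw [Finset.sum_congr rfl this, Finset.sum_const, nsmul_eq_mul, mul_comm]

theorem measurable_labelSum (m : ℝ) (n : ℕ) :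
    Measurable fun p : Config d × (Vertex d → ℝ) => labelSum m n p.1 p.2 := by
  -- Giving infinite clusters the colour `m` makes their centred contribution vanish, so the random
  -- index set becomes the fixed box.
  have : (fun p : Config d × (Vertex d → ℝ) => labelSum m n p.1 p.2) =
      fun p => ∑ x ∈ box d n, (colorOf m p.1 p.2 x - m) := by
    funext p
    rw [sum_box_colorOf, sub_self, zero_mul, add_zero]
  rw [this]
  exact Finset.measurable_fun_sum _ fun x _ =>
    ((measurable_pi_apply x).comp (measurable_colorOf m)).sub_const m

theorem measurableSet_mem_infiniteVertices (x : Vertex d) :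
    MeasurableSet {ω : Config d | x ∈ infiniteVertices ω} :=
  (measurableSet_cluster_finite x).compl

theorem measurable_card_boxInfinite (n : ℕ) :
    Measurable fun ω : Config d => ((boxInfinite n ω).card : ℝ) := by
  classical
  have : (fun ω : Config d => ((boxInfinite n ω).card : ℝ)) =
      fun ω => ∑ x ∈ box d n, if x ∈ infiniteVertices ω then (1 : ℝ) else 0 := by
    funext ω
    rw [Finset.sum_boole]
    unfold boxInfinite
    congr!
  rw [this]
  exact Finset.measurable_fun_sum _ fun x _ =>
    Measurable.ite (measurableSet_mem_infiniteVertices x) measurable_const measurable_const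

theorem measurable_sum_boxFinite (m : ℝ) (n : ℕ) :
    Measurable fun p : Config d × (Vertex d → ℝ) => ∑ x ∈ boxFinite n p.1, (p.2 x - m) := by
  classical
  simp only [sum_boxFinite_eq_sum_ite, Set.indicator_apply]
  exact Finset.measurable_fun_sum _ fun x _ => Measurable.ite
    (measurable_fst (measurableSet_mem_infiniteVertices x).compl) (by fun_prop) measurable_const

/-! ### The characteristic function given the graph -/

section CharacteristicFunction

variable (ν : Measure ℝ) [IsProbabilityMeasure ν]

theorem integral_exp_sum_infinitePi {ι : Type*} (s : Finset ι) (w : ι → ℝ) (m : ℝ) :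
    ∫ ξ, Complex.exp (((∑ r ∈ s, w r * (ξ r - m) : ℝ) : ℂ) * Complex.I)
      ∂(Measure.infinitePi fun _ : ι => ν) = ∏ r ∈ s, charFun (ν.map (· - m)) (w r) := by
  have hi : iIndepFun (fun (r : ι) (ξ : ι → ℝ) => w r * (ξ r - m))
      (Measure.infinitePi fun _ : ι => ν) :=
    iIndepFun_infinitePi (X := fun r t => w r * (t - m)) (by fun_prop)
  have hm : ∀ r, Measurable fun ξ : ι → ℝ => w r * (ξ r - m) := fun r => by
    have h : Measurable fun ξ : ι → ℝ => ξ r := measurable_pi_apply r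
    exact (h.sub_const m).const_mul (w r)
  -- Frequency `1` is enough, since the weights `w` already carry the frequency.
  have h1 := congrFun ((hi.restrict s).charFun_map_fun_finsetSum_eq_prod
    fun r _ => (hm r).aemeasurable) 1
  rw [charFun_map_real (Finset.measurable_fun_sum s fun r _ => hm r).aemeasurable] at h1
  simp only [one_mul] at h1
  rw [h1]
  simp only [Finset.prod_apply]
  refine Finset.prod_congr rfl fun r _ => ?_
  have h2 := Measure.infinitePi_map_eval (fun _ : ι => ν) r
  have h3 := integral_map (μ := Measure.infinitePi fun _ : ι => ν)
    (measurable_pi_apply r).aemeasurable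
    (f := fun x : ℝ => Complex.exp (((w r * (x - m) : ℝ) : ℂ) * Complex.I)) (by fun_prop)
  rw [h2] at h3
  rw [charFun_map_real (hm r).aemeasurable, charFun_map_real (by fun_prop), h3]
  simp only [one_mul]

theorem integral_exp_labelSum (m c : ℝ) (n : ℕ) (ω : Config d) :
    ∫ ξ, Complex.exp (((c * labelSum m n ω ξ : ℝ) : ℂ) * Complex.I)
      ∂(Measure.infinitePi fun _ : Vertex d => ν) =
    ∏ r ∈ (boxFinite n ω).image (root ω), charFun (ν.map (· - m)) (c * rootCount n ω r) := by
  rw [← integral_exp_sum_infinitePi]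
  simp only [labelSum_eq_rootSum, Finset.mul_sum, mul_assoc]

/-- Given the graph, the characteristic function of the sum of the labels is close to that of the
normal law with the conditional variance. -/
theorem norm_integral_exp_labelSum_sub_le {m σ2 ε δ K : ℝ} (hσ : 0 ≤ σ2) (hK : 0 ≤ K)
    (hε : 0 ≤ ε)
    (hb : ∀ t : ℝ, ‖charFun (ν.map (· - m)) t - Complex.exp (-((σ2 * t ^ 2 / 2 : ℝ) : ℂ))‖
      ≤ t ^ 2 * (ε + if δ ≤ |t| then K else 0)) (t : ℝ) (n : ℕ) (ω : Config d) :
    ‖∫ ξ, Complex.exp (((t / √(box d n).card * labelSum m n ω ξ : ℝ) : ℂ) * Complex.I)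
      ∂(Measure.infinitePi fun _ : Vertex d => ν) -
      ((Real.exp (-(σ2 * t ^ 2 / 2 * normalizedVariance n ω)) : ℝ) : ℂ)‖ ≤
    t ^ 2 * (((box d n).card : ℝ)⁻¹ * ∑ x ∈ box d n, ((finCluster ω x).card : ℝ) *
      (ε + if δ * √(box d n).card ≤ |t| * (finCluster ω x).card then K else 0)) := by
  have hN := card_box_pos d n
  have hsN : 0 < √((box d n).card : ℝ) := Real.sqrt_pos.2 hN
  set N : ℝ := ((box d n).card : ℝ)
  set c := t / √N
  have hc2 : c ^ 2 = t ^ 2 * N⁻¹ := by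
    rw [div_pow, Real.sq_sqrt hN.le, div_eq_mul_inv]
  -- The Gaussian is split into one factor per cluster, to be compared factor by factor with the
  -- product of characteristic functions.
  have hexp : ((Real.exp (-(σ2 * t ^ 2 / 2 * normalizedVariance n ω)) : ℝ) : ℂ) =
      ∏ r ∈ (boxFinite n ω).image (root ω),
        Complex.exp (-((σ2 * (c * rootCount n ω r) ^ 2 / 2 : ℝ) : ℂ)) := by
    rw [← Complex.exp_sum, Complex.ofReal_exp, Finset.sum_neg_distrib, ← Complex.ofReal_sum,
      ← Complex.ofReal_neg]
    congr 3
    have h1 := sum_rootCount_mul n ω fun _ => 1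
    simp only [mul_one] at h1
    rw [normalizedVariance, ← h1, Finset.mul_sum, Finset.mul_sum]
    refine Finset.sum_congr rfl fun r _ => ?_
    rw [mul_pow, hc2]
    ring
  have hprob : IsProbabilityMeasure (ν.map (· - m)) :=
    Measure.isProbabilityMeasure_map (by fun_prop)
  rw [integral_exp_labelSum, hexp]
  refine (norm_prod_sub_prod_le _ _ _ (fun r _ => norm_charFun_le_one _)
    (fun r _ => norm_exp_neg_le_one (by positivity))).trans
    ((Finset.sum_le_sum fun r _ => hb (c * rootCount n ω r)).trans ?_)
  have h2 := sum_rootCount_mul n ω fun k => ε + if δ ≤ |c * k| then K else 0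
  calc _ = c ^ 2 * ∑ r ∈ (boxFinite n ω).image (root ω), (rootCount n ω r : ℝ) ^ 2 *
        (ε + if δ ≤ |c * rootCount n ω r| then K else 0) := by
        rw [Finset.mul_sum]
        exact Finset.sum_congr rfl fun r _ => by rw [mul_pow, mul_assoc]
    _ = t ^ 2 * (N⁻¹ * ∑ x ∈ box d n, (clusterCount n ω x : ℝ) *
        (ε + if δ ≤ |c * clusterCount n ω x| then K else 0)) := by rw [h2, hc2, mul_assoc]
    _ ≤ _ := by
      -- The bound is monotone in the count, so the trace may be replaced by the whole cluster. The
      -- summand is then stationary in `x`.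
      have hle : ∀ x, (clusterCount n ω x : ℝ) ≤ (finCluster ω x).card := fun x => by
        exact_mod_cast clusterCount_le n ω x
      have hif : ∀ p : Prop, [Decidable p] → 0 ≤ if p then K else 0 := fun p _ => by
        split_ifs <;> simp [hK]
      refine mul_le_mul_of_nonneg_left (mul_le_mul_of_nonneg_left (Finset.sum_le_sum fun x _ =>
        mul_le_mul (hle x) (add_le_add le_rfl ?_) (add_nonneg hε (hif _)) (Nat.cast_nonneg _))
        (inv_nonneg.2 hN.le)) (sq_nonneg t)
      split_ifs with h3 h4
      · exact le_rfl
      · refine absurd ?_ h4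
        rw [abs_mul, abs_div, abs_of_pos hsN, Nat.abs_cast, div_mul_eq_mul_div,
          le_div_iff₀ hsN] at h3
        exact h3.trans (mul_le_mul_of_nonneg_left (hle x) (abs_nonneg t))
      · exact hK
      · exact le_rfl

end CharacteristicFunction

/-- Dominated convergence: the threshold is of order `|Λ_n|^{1/2}`, which diverges as `d ≥ 1`, so
for each graph the indicator is eventually zero. -/
theorem tendsto_integral_card_finCluster_tail {φ : Measure (Config d)}
    (hd : 1 ≤ d) (hint : Integrable (fun ω => ((finCluster ω 0).card : ℝ)) φ) {δ K : ℝ} (hδ : 0 < δ)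
    (hK : 0 ≤ K) (t : ℝ) :
    Tendsto (fun n => ∫ ω, ((finCluster ω 0).card : ℝ) *
      (if δ * √(box d n).card ≤ |t| * (finCluster ω 0).card then K else 0) ∂φ) atTop (𝓝 0) := by
  have h0 : Tendsto (fun n : ℕ => δ * √(box d n).card) atTop atTop := by
    have h1 : Tendsto (fun n : ℕ => ((box d n).card : ℝ)) atTop atTop := by
      refine tendsto_atTop_mono (fun n => ?_) tendsto_natCast_atTop_atTop
      rw [card_box]
      have : 2 * n + 1 ≤ (2 * n + 1) ^ d := Nat.le_self_pow (by omega) _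
      exact_mod_cast (by omega : n ≤ (2 * n + 1) ^ d)
    exact (Real.tendsto_sqrt_atTop.comp h1).const_mul_atTop hδ
  have hlim := tendsto_integral_of_dominated_convergence (μ := φ) (f := fun _ => (0 : ℝ))
    (F := fun n ω => ((finCluster ω 0).card : ℝ) *
      (if δ * √(box d n).card ≤ |t| * (finCluster ω 0).card then K else 0))
    (fun ω => ((finCluster ω 0).card : ℝ) * K)
    (fun n => (measurable_comp_finCluster 0 fun S => (S.card : ℝ) *
      (if δ * √(box d n).card ≤ |t| * S.card then K else 0)).aestronglyMeasurable)
    (hint.mul_const K) (fun n => Eventually.of_forall fun ω => ?_)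
    (Eventually.of_forall fun ω => ?_)
  · simpa using hlim
  · rw [norm_mul, Real.norm_natCast]
    gcongr
    split_ifs
    · rw [Real.norm_of_nonneg hK]
    · simpa using hK
  · refine tendsto_const_nhds.congr' ?_
    filter_upwards [h0.eventually_gt_atTop (|t| * (finCluster ω 0).card)] with n hn
    rw [if_neg (not_le.2 hn), mul_zero]

/-! ### Convergence of the conditional laws and asymptotic independence -/

section Core

variable {φ : Measure (Config d)} [IsProbabilityMeasure φ] {ν : Measure ℝ} [IsProbabilityMeasure ν]

theorem stronglyMeasurable_integral_exp_labelSum (m c : ℝ) (n : ℕ) :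
    StronglyMeasurable fun ω : Config d =>
      ∫ ξ, Complex.exp (((c * labelSum m n ω ξ : ℝ) : ℂ) * Complex.I)
        ∂(Measure.infinitePi fun _ : Vertex d => ν) := by
  have hm : Measurable fun p : Config d × (Vertex d → ℝ) =>
      Complex.exp (((c * labelSum m n p.1 p.2 : ℝ) : ℂ) * Complex.I) := by
    have := measurable_labelSum (d := d) m n
    fun_prop
  exact hm.stronglyMeasurable.integral_prod_right

theorem norm_exp_ofReal_mul_I_le (x : ℝ) : ‖Complex.exp ((x : ℂ) * Complex.I)‖ ≤ 1 :=
  (Complex.norm_exp_ofReal_mul_I x).le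

/-- Quenched central limit theorem: the conditional characteristic functions converge in `L¹`. -/
theorem tendsto_integral_norm_integral_exp_labelSum_sub (hd : 1 ≤ d) (hE : ConditionE φ)
    (hint : Integrable (fun ω => ((finCluster ω 0).card : ℝ)) φ) (hν : MemLp id 2 ν)
    {m σ2 : ℝ} (hm : m = ∫ x, x ∂ν) (hσ : σ2 = ∫ x, (x - m) ^ 2 ∂ν) (t : ℝ) :
    Tendsto (fun n => ∫ ω, ‖∫ ξ, Complex.exp (((t / √(box d n).card * labelSum m n ω ξ : ℝ) : ℂ) *
        Complex.I) ∂(Measure.infinitePi fun _ : Vertex d => ν) -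
      ((Real.exp (-(chiF φ * σ2 * t ^ 2 / 2)) : ℝ) : ℂ)‖ ∂φ) atTop (𝓝 0) := by
  have hσ0 : 0 ≤ σ2 := hσ ▸ integral_nonneg fun x => sq_nonneg _
  have hχ := integral_card_finCluster φ hint
  have hV := tendsto_integral_abs_normalizedVariance_sub hE hint
  rw [hχ] at hV
  have hχ0 : 0 ≤ chiF φ := hχ ▸ integral_nonneg fun ω => Nat.cast_nonneg _
  have hprob : IsProbabilityMeasure (ν.map (· - m)) :=
    Measure.isProbabilityMeasure_map (by fun_prop)
  have hνm : MemLp (fun x : ℝ => x - m) 2 ν := hν.sub (memLp_const m)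
  have hmem : MemLp id 2 (ν.map (· - m)) :=
    (memLp_map_measure_iff (by fun_prop) (by fun_prop)).2 hνm
  have hid : Integrable (fun x : ℝ => x) ν := hν.integrable one_le_two
  have hmean : ∫ x, x ∂(ν.map (· - m)) = 0 := by
    rw [integral_map (by fun_prop) (by fun_prop),
      integral_sub hid (integrable_const m), ← hm]
    simp
  have hvar : ∫ x, x ^ 2 ∂(ν.map (· - m)) = σ2 := by
    rw [integral_map (by fun_prop) (by fun_prop), hσ]
  rw [Metric.tendsto_atTop]
  intro η hη
  obtain ⟨ε, hε, hεη⟩ : ∃ ε > 0, t ^ 2 * (ε * chiF φ) < η := by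
    -- The `+ 1` covers `t = 0` and `chiF φ = 0`.
    refine ⟨η / (t ^ 2 * chiF φ + 1), by positivity, ?_⟩
    have h1 : 0 < t ^ 2 * chiF φ + 1 := by positivity
    rw [div_mul_eq_mul_div, mul_div_assoc', div_lt_iff₀ h1]
    nlinarith
  obtain ⟨δ, hδ, K, hK, hb⟩ := exists_norm_charFun_sub_exp_le hmem hmean hε
  rw [hvar] at hb
  have hbound : Tendsto (fun n => t ^ 2 * (ε * chiF φ + ∫ ω, ((finCluster ω 0).card : ℝ) *
      (if δ * √(box d n).card ≤ |t| * (finCluster ω 0).card then K else 0) ∂φ) +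
      σ2 * t ^ 2 / 2 * ∫ ω, |normalizedVariance n ω - chiF φ| ∂φ) atTop
      (𝓝 (t ^ 2 * (ε * chiF φ))) := by
    simpa using (((tendsto_integral_card_finCluster_tail hd hint hδ hK t).const_add
      (ε * chiF φ)).const_mul (t ^ 2)).add (hV.const_mul (σ2 * t ^ 2 / 2))
  obtain ⟨M, hM⟩ := eventually_atTop.1 (hbound.eventually_lt_const hεη)
  refine ⟨M, fun n hn => ?_⟩
  rw [Real.dist_eq, sub_zero, abs_of_nonneg (integral_nonneg fun ω => norm_nonneg _)]
  refine lt_of_le_of_lt ?_ (hM n hn)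
  let T : ℕ → ℝ := fun k => (k : ℝ) * (ε + if δ * √(box d n).card ≤ |t| * k then K else 0)
  have hTi : Integrable (fun ω => T (finCluster ω 0).card) φ := by
    refine (hint.mul_const (ε + K)).mono'
      (measurable_comp_finCluster 0 fun S => T S.card).aestronglyMeasurable
      (Eventually.of_forall fun ω => ?_)
    simp only [T]
    rw [norm_mul, Real.norm_natCast]
    gcongr
    split_ifs
    · rw [Real.norm_of_nonneg (by positivity)]
    · rw [add_zero, Real.norm_of_nonneg hε.le]
      linarith
  have hTix : ∀ x : Vertex d, Integrable (fun ω => T (finCluster ω x).card) φ := by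
    intro x
    have := (measurePreserving_vadd x φ).integrable_comp_of_integrable hTi
    simpa only [Function.comp_def, card_finCluster_vadd] using this
  have hTx : ∀ x : Vertex d, ∫ ω, T (finCluster ω x).card ∂φ = ∫ ω, T (finCluster ω 0).card ∂φ := by
    intro x
    rw [← integral_vadd x fun ω => T (finCluster ω 0).card]
    simp only [card_finCluster_vadd]
  have hT : ∫ ω, T (finCluster ω 0).card ∂φ = ε * chiF φ + ∫ ω, ((finCluster ω 0).card : ℝ) *
      (if δ * √(box d n).card ≤ |t| * (finCluster ω 0).card then K else 0) ∂φ := by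
    have h1 : ∀ ω : Config d, T (finCluster ω 0).card = ε * (finCluster ω 0).card +
        ((finCluster ω 0).card : ℝ) *
        (if δ * √(box d n).card ≤ |t| * (finCluster ω 0).card then K else 0) := fun ω => by
      simp only [T]
      ring
    have h2 : Integrable (fun ω => ((finCluster ω 0).card : ℝ) *
        (if δ * √(box d n).card ≤ |t| * (finCluster ω 0).card then K else 0)) φ := by
      refine (hTi.sub (hint.const_mul ε)).congr (Eventually.of_forall fun ω => ?_)
      simp only [Pi.sub_apply, h1]
      ring
    simp only [h1]
    rw [integral_add (hint.const_mul ε) h2, integral_const_mul, hχ]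
  have hTavg : Integrable (fun ω => t ^ 2 * (((box d n).card : ℝ)⁻¹ *
      ∑ x ∈ box d n, T (finCluster ω x).card)) φ :=
    ((integrable_finsetSum _ fun x _ => hTix x).const_mul _).const_mul _
  have hTavgI : ∫ ω, t ^ 2 * (((box d n).card : ℝ)⁻¹ *
      ∑ x ∈ box d n, T (finCluster ω x).card) ∂φ = t ^ 2 * ∫ ω, T (finCluster ω 0).card ∂φ := by
    rw [integral_const_mul, integral_const_mul, integral_finsetSum _ fun x _ => hTix x,
      Finset.sum_congr rfl fun x _ => hTx x, Finset.sum_const, nsmul_eq_mul,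
      inv_mul_cancel_left₀ (card_box_pos d n).ne']
  have hVi : Integrable (fun ω => σ2 * t ^ 2 / 2 * |normalizedVariance n ω - chiF φ|) φ :=
    (((integrable_normalizedVariance hint n).sub (integrable_const _)).abs).const_mul _
  rw [← hT, ← hTavgI, ← integral_const_mul, ← integral_add hTavg hVi]
  refine integral_mono_of_nonneg (Eventually.of_forall fun ω => norm_nonneg _) (hTavg.add hVi)
    (Eventually.of_forall fun ω => ?_)
  -- Pass through the Gaussian with the random conditional variance: the first error is the
  -- Lindeberg one, the second the `L¹` deviation of the variance, since `exp(-x)` is 1-Lipschitz on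
  -- `x ≥ 0`.
  refine (norm_sub_le_norm_sub_add_norm_sub _
    ((Real.exp (-(σ2 * t ^ 2 / 2 * normalizedVariance n ω)) : ℝ) : ℂ) _).trans (add_le_add
    (norm_integral_exp_labelSum_sub_le ν hσ0 hK hε.le hb t n ω) ?_)
  rw [← Complex.ofReal_sub, Complex.norm_real, Real.norm_eq_abs]
  refine (abs_exp_neg_sub_exp_neg_le (mul_nonneg (by positivity) (normalizedVariance_nonneg n ω))
    (by positivity)).trans (le_of_eq ?_)
  rw [show σ2 * t ^ 2 / 2 * normalizedVariance n ω - chiF φ * σ2 * t ^ 2 / 2 =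
    σ2 * t ^ 2 / 2 * (normalizedVariance n ω - chiF φ) by ring, abs_mul,
    abs_of_nonneg (by positivity : 0 ≤ σ2 * t ^ 2 / 2)]

/-- The sum of the labels is asymptotically normal and independent of any asymptotically normal
functional of the graph. -/
theorem tendsto_integral_exp_labelSum_add (hd : 1 ≤ d) (hE : ConditionE φ)
    (hint : Integrable (fun ω => ((finCluster ω 0).card : ℝ)) φ) (hν : MemLp id 2 ν)
    {m σ2 : ℝ} (hm : m = ∫ x, x ∂ν) (hσ : σ2 = ∫ x, (x - m) ^ 2 ∂ν) {W : ℕ → Config d → ℝ}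
    (hWm : ∀ n, Measurable (W n)) {s t : ℝ}
    (hW : Tendsto (fun n => ∫ ω, Complex.exp (((t * W n ω : ℝ) : ℂ) * Complex.I) ∂φ) atTop
      (𝓝 ((Real.exp (-(s * t ^ 2 / 2)) : ℝ) : ℂ))) :
    Tendsto (fun n => ∫ p, Complex.exp (((t * (labelSum m n p.1 p.2 / √(box d n).card + W n p.1) :
        ℝ) : ℂ) * Complex.I) ∂(φ.prod (Measure.infinitePi fun _ : Vertex d => ν))) atTop
      (𝓝 ((Real.exp (-((chiF φ * σ2 + s) * t ^ 2 / 2)) : ℝ) : ℂ)) := by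
  set P := Measure.infinitePi fun _ : Vertex d => ν
  let Ψ : ℕ → Config d → ℂ := fun n ω =>
    ∫ ξ, Complex.exp (((t / √(box d n).card * labelSum m n ω ξ : ℝ) : ℂ) * Complex.I) ∂P
  let E : ℕ → Config d → ℂ := fun n ω => Complex.exp (((t * W n ω : ℝ) : ℂ) * Complex.I)
  set e : ℂ := ((Real.exp (-(chiF φ * σ2 * t ^ 2 / 2)) : ℝ) : ℂ)
  have hE1 : ∀ n ω, ‖E n ω‖ ≤ 1 := fun n ω => norm_exp_ofReal_mul_I_le _
  have hEm : ∀ n, Measurable (E n) := fun n => by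
    have := hWm n
    fun_prop
  have hEi : ∀ n, Integrable (E n) φ := fun n =>
    (integrable_const (1 : ℝ)).mono' (hEm n).aestronglyMeasurable (Eventually.of_forall (hE1 n))
  have hΨm : ∀ n, StronglyMeasurable (Ψ n) := fun n =>
    stronglyMeasurable_integral_exp_labelSum m _ n
  have hΨ1 : ∀ n ω, ‖Ψ n ω‖ ≤ 1 := fun n ω => by
    refine (norm_integral_le_of_norm_le_const (C := 1)
      (Eventually.of_forall fun ξ => norm_exp_ofReal_mul_I_le _)).trans ?_
    simp
  have hEΨi : ∀ n, Integrable (fun ω => E n ω * Ψ n ω) φ := fun n =>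
    (integrable_const (1 : ℝ)).mono'
      ((hEm n).aestronglyMeasurable.mul (hΨm n).aestronglyMeasurable)
      (Eventually.of_forall fun ω => by
        rw [norm_mul]
        exact mul_le_one₀ (hE1 n ω) (norm_nonneg _) (hΨ1 n ω))
  -- By Fubini, integrating the labels first leaves the graph factor `E` outside.
  have hFub : ∀ n, ∫ p, Complex.exp (((t * (labelSum m n p.1 p.2 / √(box d n).card + W n p.1) :
      ℝ) : ℂ) * Complex.I) ∂(φ.prod P) = ∫ ω, E n ω * Ψ n ω ∂φ := by
    intro n
    have hmeas : Measurable fun p : Config d × (Vertex d → ℝ) =>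
        Complex.exp (((t * (labelSum m n p.1 p.2 / √(box d n).card + W n p.1) : ℝ) : ℂ) *
          Complex.I) := by
      have h1 := measurable_labelSum (d := d) m n
      have h2 : Measurable fun p : Config d × (Vertex d → ℝ) => W n p.1 :=
        (hWm n).comp measurable_fst
      fun_prop
    rw [integral_prod _ ((integrable_const (1 : ℝ)).mono' hmeas.aestronglyMeasurable
      (Eventually.of_forall fun p => norm_exp_ofReal_mul_I_le _))]
    refine integral_congr_ae (Eventually.of_forall fun ω => ?_)
    simp only [E, Ψ]
    rw [← integral_const_mul]
    refine integral_congr_ae (Eventually.of_forall fun ξ => ?_)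
    simp only
    rw [← Complex.exp_add, ← add_mul, ← Complex.ofReal_add]
    congr 3
    ring
  simp only [hFub]
  have hlim : Tendsto (fun n => (∫ ω, E n ω ∂φ) * e) atTop
      (𝓝 ((Real.exp (-((chiF φ * σ2 + s) * t ^ 2 / 2)) : ℝ) : ℂ)) := by
    have h1 := hW.mul_const e
    rw [← Complex.ofReal_mul, ← Real.exp_add] at h1
    convert h1 using 4
    ring
  -- As `‖E‖ ≤ 1`, replacing `Ψ` by the constant `e` costs at most `‖Ψ - e‖₁`; no independence is
  -- needed.
  have hdiff : Tendsto (fun n => ∫ ω, E n ω * Ψ n ω ∂φ - (∫ ω, E n ω ∂φ) * e) atTop (𝓝 0) := by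
    refine squeeze_zero_norm (fun n => ?_)
      (tendsto_integral_norm_integral_exp_labelSum_sub hd hE hint hν hm hσ t)
    rw [← integral_mul_const, ← integral_sub (hEΨi n) ((hEi n).mul_const e)]
    refine norm_integral_le_of_norm_le ?_ (Eventually.of_forall fun ω => ?_)
    · refine Integrable.norm (Integrable.sub ?_ (integrable_const _))
      exact (integrable_const (1 : ℝ)).mono' (hΨm n).aestronglyMeasurable
        (Eventually.of_forall (hΨ1 n))
    · rw [← mul_sub, norm_mul]
      exact mul_le_of_le_one_left (norm_nonneg _) (hE1 n ω)
  simpa using hdiff.add hlim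

end Core

/-! ### The coupling with independent labels -/

section Transfer

variable (φ : Measure (Config d)) [IsProbabilityMeasure φ] (ν : Measure ℝ) [IsProbabilityMeasure ν]

theorem jointColorMeasure_eq_map (z : ℝ) :
    jointColorMeasure φ ν z = (φ.prod (Measure.infinitePi fun _ : Vertex d => ν)).map
      fun p => (p.1, colorOf z p.1 p.2) := by
  have hT : Measurable fun p : Config d × (Vertex d → ℝ) => (p.1, colorOf z p.1 p.2) :=
    measurable_fst.prodMk (measurable_colorOf z)
  ext s hs
  rw [Measure.compProd_apply hs, Measure.map_apply hT hs, Measure.prod_apply (hT hs)]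
  refine lintegral_congr fun ω => ?_
  exact Measure.map_apply (measurable_colorOf_right z ω) (measurable_prodMk_left hs)

theorem randomColorMeasure_eq_map (z : ℝ) :
    randomColorMeasure φ ν z = (φ.prod (Measure.infinitePi fun _ : Vertex d => ν)).map
      fun p => colorOf z p.1 p.2 := by
  refine (Measure.snd_compProd φ (colorKernel ν z)).symm.trans ?_
  rw [show φ ⊗ₘ colorKernel ν z = _ from jointColorMeasure_eq_map φ ν z, Measure.snd,
    Measure.map_map measurable_snd (measurable_fst.prodMk (measurable_colorOf z))]
  rfl

end Transfer

theorem mem_infiniteVertices_vadd (k : Vertex d) (ω : Config d) :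
    0 ∈ infiniteVertices (k +ᵥ ω) ↔ k ∈ infiniteVertices ω := by
  simp only [infiniteVertices, Set.mem_ofPred_eq, cluster_vadd, zero_add]
  exact Set.infinite_image_iff sub_left_injective.injOn

/-- Invariance carries the null event from the origin to every vertex, and there are countably many
vertices. -/
theorem ae_boxInfinite_eq_empty {φ : Measure (Config d)} [IsProbabilityMeasure φ]
    (hE : ConditionE φ) (hθ : theta φ = 0) (n : ℕ) : ∀ᵐ ω ∂φ, boxInfinite n ω = ∅ := by
  have h0 : φ {ω | (0 : Vertex d) ∈ infiniteVertices ω} = 0 :=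
    (measureReal_eq_zero_iff (measure_ne_top _ _)).1 hθ
  have hx : ∀ x : Vertex d, ∀ᵐ ω ∂φ, x ∉ infiniteVertices ω := by
    intro x
    have h1 := measure_preimage_vadd_of_nullMeasurableSet (μ := φ)
      (measurableSet_mem_infiniteVertices (0 : Vertex d)).nullMeasurableSet x
    rw [h0] at h1
    rw [ae_iff]
    simpa only [Set.preimage_ofPred_eq, mem_infiniteVertices_vadd, not_not] using h1
  filter_upwards [ae_all_iff.2 hx] with ω hω
  classical
  unfold boxInfinite
  exact Finset.filter_false_of_mem fun x _ => hω x

theorem chiF_nonneg (φ : Measure (Config d)) : 0 ≤ chiF φ :=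
  tsum_nonneg fun _ => mul_nonneg (Nat.cast_nonneg _) measureReal_nonneg

end RandomColoring

/-! ### The limit theorems -/

theorem mainTheorem3 {d : ℕ} (hd : 1 ≤ d)
    (φ : Measure (Config d)) [IsProbabilityMeasure φ] (hE : ConditionE φ) (hM : ConditionM φ)
    (ν : Measure ℝ) [IsProbabilityMeasure ν] (hν : MemLp id 2 ν)
    (m σ2 : ℝ) (hm : m = ∫ x, x ∂ν) (hσ : σ2 = ∫ x, (x - m) ^ 2 ∂ν) (z : ℝ) :
    (theta φ = 0 →
      TendstoCentredNormal (jointColorMeasure φ ν z)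
        (fun n p => (∑ x ∈ boxFinite n p.1, (p.2 x - m)) /
          √((box d n).card : ℝ))
        (chiF φ * σ2) ∧
      TendstoCentredNormal (randomColorMeasure φ ν z)
        (fun n X => (∑ x ∈ box d n, (X x - m)) / √((box d n).card : ℝ))
        (chiF φ * σ2)) ∧
    (0 < theta φ → ∀ σφ2 : ℝ, ConditionCLT φ σφ2 →
      TendstoCentredNormal (randomColorMeasure φ ν z)
        (fun n X => ((∑ x ∈ box d n, X x) -
          ((1 - theta φ) * m + theta φ * z) * ((box d n).card : ℝ)) /
          √((box d n).card : ℝ))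
        (chiF φ * σ2 + (z - m) ^ 2 * σφ2)) := by
  have hint := integrable_card_finCluster hd hM
  have hσ0 : 0 ≤ σ2 := hσ ▸ integral_nonneg fun x => sq_nonneg _
  have hv0 : 0 ≤ chiF φ * σ2 := mul_nonneg (chiF_nonneg φ) hσ0
  have hTj : Measurable fun p : Config d × (Vertex d → ℝ) => (p.1, colorOf z p.1 p.2) :=
    measurable_fst.prodMk (measurable_colorOf z)
  have hTr : Measurable fun p : Config d × (Vertex d → ℝ) => colorOf z p.1 p.2 :=
    measurable_colorOf z
  have hcard := measurable_card_boxInfinite (d := d)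
  refine ⟨fun hθ => ⟨?_, ?_⟩, fun _ σφ2 ⟨hs, hclt⟩ => ?_⟩
  · have hYm : ∀ n, Measurable fun p : Config d × (Vertex d → ℝ) =>
        (∑ x ∈ boxFinite n p.1, (p.2 x - m)) / √((box d n).card : ℝ) := fun n =>
      (measurable_sum_boxFinite m n).div_const _
    rw [tendstoCentredNormal_iff hv0 fun n => (hYm n).aemeasurable]
    intro t
    have h := tendsto_integral_exp_labelSum_add hd hE hint hν hm hσ (W := fun _ _ => 0)
      (fun _ => measurable_const) (s := 0) (t := t) (by simp)
    rw [add_zero] at h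
    refine h.congr fun n => ?_
    have hem : Measurable fun p : Config d × (Vertex d → ℝ) => Complex.exp
        (((t * ((∑ x ∈ boxFinite n p.1, (p.2 x - m)) / √((box d n).card : ℝ)) : ℝ) : ℂ) *
          Complex.I) := by
      have := hYm n
      fun_prop
    rw [jointColorMeasure_eq_map, integral_map hTj.aemeasurable hem.aestronglyMeasurable]
    simp only [labelSum_eq_colorOf m z, add_zero]
  · have hYm : ∀ n, Measurable fun X : Vertex d → ℝ =>
        (∑ x ∈ box d n, (X x - m)) / √((box d n).card : ℝ) := fun n => by fun_prop
    rw [tendstoCentredNormal_iff hv0 fun n => (hYm n).aemeasurable]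
    intro t
    have h := tendsto_integral_exp_labelSum_add hd hE hint hν hm hσ
      -- The graph term is kept so that the decomposition of the box sum holds everywhere; it
      -- vanishes almost surely, hence `s = 0`.
      (W := fun n ω => (z - m) * (boxInfinite n ω).card / √((box d n).card : ℝ))
      (fun n => ((hcard n).const_mul _).div_const _) (s := 0) (t := t) (by
        have h1 : ∀ n, ∫ ω, Complex.exp (((t * ((z - m) * (boxInfinite n ω).card /
            √((box d n).card : ℝ)) : ℝ) : ℂ) * Complex.I) ∂φ = 1 := by
          intro n
          have h2 : ∫ ω, Complex.exp (((t * ((z - m) * (boxInfinite n ω).card /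
              √((box d n).card : ℝ)) : ℝ) : ℂ) * Complex.I) ∂φ = ∫ _, (1 : ℂ) ∂φ := by
            refine integral_congr_ae ?_
            filter_upwards [ae_boxInfinite_eq_empty hE hθ n] with ω hω
            simp [hω]
          simpa using h2
        simp only [h1]
        simp)
    rw [add_zero] at h
    refine h.congr fun n => ?_
    have hem : Measurable fun X : Vertex d → ℝ => Complex.exp
        (((t * ((∑ x ∈ box d n, (X x - m)) / √((box d n).card : ℝ)) : ℝ) : ℂ) * Complex.I) := by
      have := hYm n
      fun_prop
    rw [randomColorMeasure_eq_map, integral_map hTr.aemeasurable hem.aestronglyMeasurable]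
    simp only [sum_box_colorOf, add_div]
  · have hYm : ∀ n, Measurable fun X : Vertex d → ℝ => ((∑ x ∈ box d n, X x) -
          ((1 - theta φ) * m + theta φ * z) * ((box d n).card : ℝ)) /
          √((box d n).card : ℝ) := fun n => by fun_prop
    have hWm : ∀ n, Measurable fun ω : Config d =>
        (((boxInfinite n ω).card : ℝ) - theta φ * ((box d n).card : ℝ)) /
          √((box d n).card : ℝ) := fun n => ((hcard n).sub_const _).div_const _
    rw [tendstoCentredNormal_iff (by positivity) fun n => (hYm n).aemeasurable]
    rw [tendstoCentredNormal_iff hs.le fun n => (hWm n).aemeasurable] at hclt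
    intro t
    have h := tendsto_integral_exp_labelSum_add hd hE hint hν hm hσ
      (W := fun n ω => (z - m) * ((((boxInfinite n ω).card : ℝ) -
        theta φ * ((box d n).card : ℝ)) / √((box d n).card : ℝ)))
      (fun n => (hWm n).const_mul _) (s := (z - m) ^ 2 * σφ2) (t := t) (by
        -- Scaling by `z - m` is absorbed into the frequency, so the case `z = m` needs no separate
        -- treatment.
        have h1 := hclt (t * (z - m))
        rw [show σφ2 * (t * (z - m)) ^ 2 / 2 = (z - m) ^ 2 * σφ2 * t ^ 2 / 2 by ring] at h1
        simpa only [mul_assoc] using h1)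
    refine h.congr fun n => ?_
    have hem : Measurable fun X : Vertex d → ℝ => Complex.exp
        (((t * (((∑ x ∈ box d n, X x) - ((1 - theta φ) * m + theta φ * z) *
          ((box d n).card : ℝ)) / √((box d n).card : ℝ)) : ℝ) : ℂ) * Complex.I) := by
      have := hYm n
      fun_prop
    rw [randomColorMeasure_eq_map, integral_map hTr.aemeasurable hem.aestronglyMeasurable]
    refine integral_congr_ae (Eventually.of_forall fun p => ?_)
    -- The centring matches because `(1 - θ)m + θz = m + θ(z - m)`.
    have h2 := sum_box_colorOf m z n p.1 p.2
    rw [Finset.sum_sub_distrib, Finset.sum_const, nsmul_eq_mul, sub_eq_iff_eq_add] at h2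
    simp only [h2]
    congr 4
    ring
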